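/- **Setting.** An input is a finite bipartite graph $G=(U,V,E)$ whose offline vertices $V=\{1,\dots,n\}$ are known in advance and whose online vertices $U$, with $|U|=m$, arrive one at a time in an adversarial order, each together with its set of neighbours in $V$. For a permutation $\sigma$ of $V$, $\textsc{Ranking}(\sigma)$ is the greedy algorithm that matches each arriving $u$ that has a currently unmatched neighbour to its unmatched neighbour $v$ of smallest rank $\sigma(v)$. The $k$-pass Category-Advice algorithm starts with $c(v)=-\infty$ for all $v\in V$. In pass $i=1,\dots,k$ (the online vertices arrive in the same order in all passes) it computes the matching $M_i=\textsc{Ranking}(\sigma_c)$, where $\sigma_c$ sorts $V$ by increasing $c$ and breaks ties by name, and afterwards it sets $c(v):=-i$ for every $v$ matched in $M_i$ with $c(v)=-\infty$. It returns $M_k$. Write $\mathrm{ALG}_k(G)=|M_k|$ (and $\mathrm{ALG}_0(G)=0$), and let $\mathrm{OPT}(G)$ be the maximum size of a matching of $G$. The (asymptotic) approximation ratio of an algorithm $\mathrm{ALG}$ is $$\mathrm{AR}(\mathrm{ALG})=\lim_{N\to\infty}\ \inf_{G:\ \mathrm{OPT}(G)\ge N}\ \frac{\mathrm{ALG}(G)}{\mathrm{OPT}(G)}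 .$$ Let $F_1=F_2=1$ and $F_j=F_{j-1}+F_{j-2}$ for $j\ge 3$. **Theorem.** 1. For every $k\ge1$, the exact approximation ratio of $k$-pass Category-Advice is $F_{2k}/F_{2k+1}$. That is, $\mathrm{ALG}_k(G)\ge \frac{F_{2k}}{F_{2k+1}}\,\mathrm{OPT}(G)$ for every $G$, and $\mathrm{AR}(\mathrm{ALG}_k)=F_{2k}/F_{2k+1}$. Moreover there is a graph $G_k$ with $F_{2k+1}$ online and $F_{2k+1}$ offline vertices that has a perfect matching and satisfies $\mathrm{ALG}_k(G_k)=F_{2k}$ and $\mathrm{ALG}_{k'}(G_k)=F_{2k}+1$ for all $k'>k$. 2. $\mathrm{AR}(\mathrm{ALG}_k)\to 2/(1+\sqrt5)$ as $k\to\infty$. 3. This holds even when the number of passes depends arbitrarily on the size of the input. Let $\kappa:\mathbb N\times\mathbb N\to\mathbb N$ be any function, and run $\kappa(|U|,|V|)$ passes on $G=(U,V,E)$. The approximation ratio of the resulting algorithm exists and is at most $2/(1+\sqrt5)$; if $\kappa(m,n)\to\infty$ as $m,n\to\infty$, it is equal to $2/(1+\sqrt5)$. 4. For every constant $k\ge1$,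 $k$-pass Category-Advice can be implemented as a $k$-pass semi-streaming algorithm using $O(n)$ bits of memory, where $n=|V|$. That is, there are a constant $C$ and one deterministic streaming algorithm with a computable transition rule such that, on every $G$, when the algorithm makes $k$ passes over the stream that lists, for each online vertex in order of arrival, its neighbours one by one in an arbitrary order followed by an end marker (and an end-of-pass marker at the end), it never holds more than $C(n+1)$ bits of memory between two tokens of the stream, and in the $k$-th pass, at the end marker of each online vertex, it outputs (to a write-only output) the partner of that vertex in $M_k$, or that the vertex is unmatched. -/

import Mathlib

/-- A bipartite graph `G = (U, V, E)` presented online. The online side `U` is identified with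
`Fin numOnline`, a vertex being its position in the arrival order chosen by the adversary; the
offline side `V` is `Fin numOffline`, ordered by names; `nbrs u` is the set of neighbours of `u`. -/
structure OnlineBipartite where
  numOnline : ℕ
  numOffline : ℕ
  nbrs : Fin numOnline → Finset (Fin numOffline)

namespace OnlineBipartite

variable (G : OnlineBipartite)

/-- Sets of pairs (online vertex, offline vertex). -/
abbrev EdgeSet : Type := Finset (Fin G.numOnline × Fin G.numOffline)

/-- `M` is a matching of `G`: its members are edges, and no two of them share an endpoint. -/
def IsMatching (M : G.EdgeSet) : Prop :=
  (∀ e ∈ M, e.2 ∈ G.nbrs e.1) ∧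
    ∀ e ∈ M, ∀ f ∈ M, e.1 = f.1 ∨ e.2 = f.2 → e = f

instance (M : G.EdgeSet) : Decidable (G.IsMatching M) := by
  unfold IsMatching; infer_instance

/-- `OPT(G)`: the maximum size of a matching of `G`. -/
def opt : ℕ := (Finset.univ.filter fun M : G.EdgeSet => G.IsMatching M).sup Finset.card

/-- The neighbours of `u` that are not yet matched by `M`. -/
def available (M : G.EdgeSet) (u : Fin G.numOnline) : Finset (Fin G.numOffline) :=
  (G.nbrs u).filter fun v => ∀ u', (u', v) ∉ M

/-- Arrival of `u` in Ranking: if `u` has an unmatched neighbour, it is matched with the unmatched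
neighbour `v` that minimizes the rank `σ v`. -/
def rankingStep (σ : Equiv.Perm (Fin G.numOffline)) (M : G.EdgeSet) (u : Fin G.numOnline) :
    G.EdgeSet :=
  if h : (G.available M u).Nonempty then
    insert (u, σ.symm (((G.available M u).image σ).min' (h.image σ))) M
  else M

/-- The matching found by Ranking with the permutation `σ` of the offline vertices. -/
def ranking (σ : Equiv.Perm (Fin G.numOffline)) : G.EdgeSet :=
  (List.finRange G.numOnline).foldl (G.rankingStep σ) ∅

end OnlineBipartite

/-- The permutation `σ_c` for the category function `c` and the identity permutation `σ`: the rank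
of each vertex when vertices are sorted by category, ties being broken by name
(see `categoryPerm_lt_iff`). -/
def categoryPerm {n : ℕ} (c : Fin n → WithBot ℤ) : Equiv.Perm (Fin n) := (Tuple.sort c).symm

/-- The defining property of `σ_c`. -/
theorem categoryPerm_lt_iff {n : ℕ} (c : Fin n → WithBot ℤ) (v w : Fin n) :
    categoryPerm c v < categoryPerm c w ↔ c v < c w ∨ (c v = c w ∧ v < w) := by
  have key : ∀ i j : Fin n, i < j →
      c (Tuple.sort c i) < c (Tuple.sort c j) ∨
        (c (Tuple.sort c i) = c (Tuple.sort c j) ∧ Tuple.sort c i < Tuple.sort c j) := by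
    intro i j hij
    have h := (Tuple.eq_sort_iff (f := c) (σ := Tuple.sort c)).1 rfl
    rcases (h.1 hij.le).lt_or_eq with h1 | h1
    · exact Or.inl h1
    · exact Or.inr ⟨h1, h.2 i j hij h1⟩
  obtain ⟨i, rfl⟩ := (Tuple.sort c).surjective v
  obtain ⟨j, rfl⟩ := (Tuple.sort c).surjective w
  simp only [categoryPerm, Equiv.symm_apply_apply]
  refine ⟨key i j, fun h => ?_⟩
  by_contra hij
  rcases (not_lt.1 hij).lt_or_eq with h1 | h1
  · rcases key j i h1 with h2 | h2 <;> rcases h with h3 | h3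
    · exact lt_asymm h2 h3
    · exact h2.ne h3.1.symm
    · exact h3.ne h2.1.symm
    · exact lt_asymm h2.2 h3.2
  · subst h1
    simp at h

namespace OnlineBipartite

variable (G : OnlineBipartite)

/-- The state of Category-Advice after `k` passes: the category function `c` and the matching found
in pass `k` (`∅` for `k = 0`). Pass `i` runs Ranking with `σ_c` and then sets `c v` to `-i` for every
`v` matched in this pass for which `c v = -∞`. -/
def categoryState : ℕ → (Fin G.numOffline → WithBot ℤ) × G.EdgeSet
  | 0 => (fun _ => ⊥, ∅)
  | i + 1 =>
    let c := (categoryState i).1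
    let M := G.ranking (categoryPerm c)
    (fun v => if c v = ⊥ ∧ ∃ u, (u, v) ∈ M then ((-((i : ℤ) + 1) : ℤ) : WithBot ℤ) else c v, M)

/-- The matching returned by the `k`-pass Category-Advice algorithm. -/
def categoryAdvice (k : ℕ) : G.EdgeSet := (G.categoryState k).2

/-- The partner of the online vertex `u` in the matching `M`, if there is one. -/
def mate (M : G.EdgeSet) (u : Fin G.numOnline) : Option (Fin G.numOffline) :=
  (List.finRange G.numOffline).find? fun v => (u, v) ∈ M

end OnlineBipartite

/-- `ρ` is the asymptotic approximation ratio of a deterministic algorithm that returns a matching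
of size `alg G` on input `G`, i.e. `ρ = lim_{N → ∞} inf {alg G / OPT(G) : OPT(G) ≥ N}`. -/
def HasAsymptoticRatio (alg : OnlineBipartite → ℕ) (ρ : ℝ) : Prop :=
  Filter.Tendsto
    (fun N : ℕ => sInf {r : ℝ | ∃ G : OnlineBipartite, N ≤ G.opt ∧ r = (alg G : ℝ) / (G.opt : ℝ)})
    Filter.atTop (nhds ρ)

/-- The tokens of a stream in the vertex input model. `some (some v)`: the offline vertex `v` is a
neighbour of the current online vertex; `some none`: the list of neighbours of the current online
vertex is complete; `none`: the pass is complete. -/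
abbrev StreamToken : Type := Option (Option ℕ)

/-- A deterministic streaming algorithm. It knows the number `n` of offline vertices, and its memory
is a string of bits. On each token it updates the memory and may write the name of an offline vertex
to a write-only output. One computable rule serves all `n`. -/
structure StreamingAlgorithm where
  init : ℕ → List Bool
  step : ℕ → List Bool → StreamToken → List Bool × Option ℕ
  computable_init : Computable init
  computable_step : Computable fun p : ℕ × List Bool × StreamToken => step p.1 p.2.1 p.2.2

namespace StreamingAlgorithm

variable (A : StreamingAlgorithm)

/-- The memory after the tokens `ts` have been read. -/
def memory (n : ℕ) (ts : List StreamToken) : List Bool :=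
  ts.foldl (fun m t => (A.step n m t).1) (A.init n)

/-- What the algorithm, started with memory `m`, outputs for the online vertices that are completed
in `ts`: one entry for each token `some none`, in order of arrival. -/
def answers (n : ℕ) : List Bool → List StreamToken → List (Option ℕ)
  | _, [] => []
  | m, t :: ts =>
    if t = some none then (A.step n m t).2 :: answers n (A.step n m t).1 ts
    else answers n (A.step n m t).1 ts

end StreamingAlgorithm

/-- One pass over `G`, where `L u` lists the neighbours of `u` in some order. -/
def OnlineBipartite.passTokens (G : OnlineBipartite)
    (L : Fin G.numOnline → List (Fin G.numOffline)) : List StreamToken :=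
  ((List.finRange G.numOnline).flatMap fun u =>
    ((L u).map fun v => some (some (v : ℕ))) ++ [some none]) ++ [none]

/-- The streaming algorithm `A` implements `k`-pass Category-Advice (`1 ≤ k`): on each graph, with
neighbours listed in any order, its output during the `k`-th pass over the stream is the matching
returned by `k`-pass Category-Advice. -/
def StreamingAlgorithm.ImplementsCategoryAdvice (A : StreamingAlgorithm) (k : ℕ) : Prop :=
  ∀ (G : OnlineBipartite) (L : Fin G.numOnline → List (Fin G.numOffline)),
    (∀ u, (L u).toFinset = G.nbrs u) →
      A.answers G.numOffline
          (A.memory G.numOffline (List.replicate (k - 1) (G.passTokens L)).flatten)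
          (G.passTokens L) =
        List.ofFn fun u => (G.mate (G.categoryAdvice k) u).map Fin.val

/-- During `k` passes over any graph, `A` never holds more than `C * (n + 1)` bits of memory, where
`n` is the number of offline vertices. -/
def StreamingAlgorithm.UsesLinearSpace (A : StreamingAlgorithm) (k C : ℕ) : Prop :=
  ∀ (G : OnlineBipartite) (L : Fin G.numOnline → List (Fin G.numOffline)),
    (∀ u, (L u).toFinset = G.nbrs u) →
      ∀ ts : List StreamToken, ts <+: (List.replicate k (G.passTokens L)).flatten →
        (A.memory G.numOffline ts).length ≤ C * (G.numOffline + 1)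

/-!
Serving online vertices greedily in order of arrival yields the unique stable matching in which
offline vertices prefer early arrivals and online vertices prefer offline vertices of small rank
(`isStable_ranking`, `IsStable.unique`). All facts about a pass are derived from stability.

Two consequences carry the lower bound. Passing from one category function to the next does not
change the relative order of the vertices just matched, and then every online vertex that was
matched stays matched (`exists_mem_categoryAdvice_of_le`). And the set `N` of offline vertices
unmatched in the first pass precedes all others in every later pass, so that passes `2, …, k + 1`
act on `N` as passes `1, …, k` on the subgraph `H` with offline side `N`
(`Embeds.pullback_categoryAdvice_succ`). If `d` online vertices of an optimal matching stay
unmatched in pass `k + 1`, their `d` partners are outside `N` and matched in pass `k + 1`. Hence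
`ALG_{k+1}(G) ≥ d + ALG_k(H)`, while `d ≥ OPT(G) - ALG_{k+1}(G)` and
`OPT(H) ≥ OPT(G) - ALG_{k+1}(G)`. So a ratio `p / q` for `k` passes becomes
`(p + q) / (p + 2 * q)` for `k + 1` passes, which is the recursion of the Fibonacci numbers
(`fib_mul_opt_le`).

The tight instances invert this recursion: `extend` adds to `H` online and offline vertices such
that the first pass misses the offline side of `H`, and
`ALG_{i+1}(extend H q) = |U_H| + q + (ALG_i(H) - q)`, with truncated subtraction
(`card_categoryAdvice_extend`). Disjoint copies make these instances arbitrarily large without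
changing the ratio. Since further passes gain one vertex per copy only, they also bound the ratio
for numbers of passes that depend on the input. The asymptotic ratio always exists, as a limit of
bounded increasing infima.

For the streaming algorithm it suffices to store for every offline vertex its age, that is the
number of passes since it was first matched, and two bits: sorting by category is sorting by age
(`precedes_category_iff`). Ages are at most `k` after `k` passes, so that a unary encoding takes a
bounded number of bits per vertex.
-/

/-! ### Stable matchings -/

/-- The offline vertex `v` comes before `w` when vertices are sorted by category, ties being broken
by name. -/
def Precedes {n : ℕ} (c : Fin n → WithBot ℤ) (v w : Fin n) : Prop :=
  c v < c w ∨ (c v = c w ∧ v < w)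

theorem Precedes.asymm {n : ℕ} {c : Fin n → WithBot ℤ} {v w : Fin n} (h : Precedes c v w) :
    ¬ Precedes c w v := by
  rw [Precedes, ← categoryPerm_lt_iff] at *
  exact lt_asymm h

namespace OnlineBipartite

variable {G H : OnlineBipartite}

/-- `M` is a stable matching of `G` when online vertices prefer offline vertices that come first in
the order given by `c`, and offline vertices prefer online vertices that arrive early. -/
structure IsStable (G : OnlineBipartite) (c : Fin G.numOffline → WithBot ℤ) (M : G.EdgeSet) :
    Prop where
  isMatching : G.IsMatching M
  blocked : ∀ u, ∀ v ∈ G.nbrs u, (u, v) ∉ M →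
    (∃ u' < u, (u', v) ∈ M) ∨ ∃ v', Precedes c v' v ∧ (u, v') ∈ M

theorem IsMatching.snd_eq {M : G.EdgeSet} (h : G.IsMatching M) {u v w} (h1 : (u, v) ∈ M)
    (h2 : (u, w) ∈ M) : v = w :=
  congrArg Prod.snd (h.2 _ h1 _ h2 (Or.inl rfl))

theorem IsMatching.fst_eq {M : G.EdgeSet} (h : G.IsMatching M) {u u' v} (h1 : (u, v) ∈ M)
    (h2 : (u', v) ∈ M) : u = u' :=
  congrArg Prod.fst (h.2 _ h1 _ h2 (Or.inr rfl))

theorem mem_available {M : G.EdgeSet} {u v} :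
    v ∈ G.available M u ↔ v ∈ G.nbrs u ∧ ∀ u', (u', v) ∉ M := by
  simp [available]

theorem rankingStep_cases (σ : Equiv.Perm (Fin G.numOffline)) (M : G.EdgeSet)
    (u : Fin G.numOnline) :
    (G.available M u = ∅ ∧ G.rankingStep σ M u = M) ∨
      ∃ v ∈ G.available M u, (∀ w ∈ G.available M u, σ v ≤ σ w) ∧
        G.rankingStep σ M u = insert (u, v) M := by
  rcases Finset.eq_empty_or_nonempty (G.available M u) with h | h
  · left
    exact ⟨h, by simp [rankingStep, h]⟩
  · right
    have hm := Finset.min'_mem _ (h.image σ)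
    obtain ⟨v, hv, hve⟩ := Finset.mem_image.1 hm
    refine ⟨v, hv, fun w hw => ?_, ?_⟩
    · rw [hve]
      exact Finset.min'_le _ _ (Finset.mem_image_of_mem σ hw)
    · rw [rankingStep, dif_pos h, ← hve, Equiv.symm_apply_apply]

theorem isMatching_rankingStep (σ : Equiv.Perm (Fin G.numOffline)) {M : G.EdgeSet}
    {u : Fin G.numOnline} (hM : G.IsMatching M) (hu : ∀ v, (u, v) ∉ M) :
    G.IsMatching (G.rankingStep σ M u) := by
  rcases rankingStep_cases σ M u with ⟨-, h⟩ | ⟨v, hv, -, h⟩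
  · rwa [h]
  · rw [h]
    rw [mem_available] at hv
    refine ⟨?_, ?_⟩
    · intro e he
      rcases Finset.mem_insert.1 he with rfl | he
      · exact hv.1
      · exact hM.1 e he
    · rintro ⟨a, b⟩ he ⟨a', b'⟩ hf hef
      simp only [Finset.mem_insert, Prod.mk.injEq] at he hf
      rcases he with ⟨rfl, rfl⟩ | he <;> rcases hf with ⟨rfl, rfl⟩ | hf
      · rfl
      · rcases hef with h1 | h1
        · simp only at h1; subst h1; exact absurd hf (hu _)
        · simp only at h1; subst h1; exact absurd hf (hv.2 _)
      · rcases hef with h1 | h1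
        · simp only at h1; subst h1; exact absurd he (hu _)
        · simp only at h1; subst h1; exact absurd he (hv.2 _)
      · exact hM.2 _ he _ hf hef

/-- The partial matching of Ranking after the arrivals `us`: a matching of the arrived vertices, in
which every edge at an arrived vertex is blocked. The list `us` need only be increasing. -/
theorem ranking_foldl_invariant (c : Fin G.numOffline → WithBot ℤ) (us : List (Fin G.numOnline))
    (hus : us.Pairwise (· < ·)) :
    let M := us.foldl (G.rankingStep (categoryPerm c)) ∅
    G.IsMatching M ∧ (∀ e ∈ M, e.1 ∈ us) ∧ ∀ u ∈ us, ∀ v ∈ G.nbrs u, (u, v) ∉ M →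
      (∃ u' < u, (u', v) ∈ M) ∨ ∃ v', Precedes c v' v ∧ (u, v') ∈ M := by
  induction us using List.reverseRecOn with
  | nil => simp [IsMatching]
  | append_singleton us u ih =>
    rw [List.pairwise_append] at hus
    obtain ⟨hM, hin, hbl⟩ := ih hus.1
    have hlt : ∀ a ∈ us, a < u := fun a ha => hus.2.2 a ha u (by simp)
    simp only [List.foldl_append, List.foldl_cons, List.foldl_nil]
    set M := us.foldl (G.rankingStep (categoryPerm c)) ∅
    have hu : ∀ v, (u, v) ∉ M := fun v hv => lt_irrefl _ (hlt _ (hin _ hv))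
    refine ⟨isMatching_rankingStep _ hM hu, ?_⟩
    rcases rankingStep_cases (categoryPerm c) M u with ⟨h0, h⟩ | ⟨v, hv, hmin, h⟩
    · rw [h]
      refine ⟨fun e he => by simp [hin e he], fun a ha w hw hn => ?_⟩
      rcases List.mem_append.1 ha with ha | ha
      · exact hbl a ha w hw hn
      · obtain rfl : a = u := by simpa using ha
        by_contra hcon
        have : w ∈ G.available M a := by
          refine mem_available.2 ⟨hw, fun u' hu' => hcon (Or.inl ⟨u', hlt _ (hin _ hu'), hu'⟩)⟩
        simp [h0] at this
    · rw [h]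
      refine ⟨fun e he => ?_, fun a ha w hw hn => ?_⟩
      · rcases Finset.mem_insert.1 he with rfl | he
        · simp
        · simp [hin e he]
      · rw [Finset.mem_insert, not_or] at hn
        rcases List.mem_append.1 ha with ha | ha
        · rcases hbl a ha w hw hn.2 with ⟨u', h1, h2⟩ | ⟨v', h1, h2⟩
          · exact Or.inl ⟨u', h1, Finset.mem_insert_of_mem h2⟩
          · exact Or.inr ⟨v', h1, Finset.mem_insert_of_mem h2⟩
        · obtain rfl : a = u := by simpa using ha
          by_cases hav : w ∈ G.available M a
          · right
            refine ⟨v, ?_, Finset.mem_insert_self _ _⟩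
            rw [Precedes, ← categoryPerm_lt_iff]
            refine lt_of_le_of_ne (hmin w hav) fun he => hn.1 ?_
            rw [(categoryPerm c).injective he]
          · left
            rw [mem_available] at hav
            push Not at hav
            obtain ⟨u', hu'⟩ := hav hw
            exact ⟨u', hlt _ (hin _ hu'), Finset.mem_insert_of_mem hu'⟩

theorem isStable_ranking (c : Fin G.numOffline → WithBot ℤ) :
    G.IsStable c (G.ranking (categoryPerm c)) := by
  obtain ⟨h1, -, h3⟩ := ranking_foldl_invariant c (List.finRange G.numOnline)
    (List.pairwise_lt_finRange _)
  exact ⟨h1, fun u => h3 u (List.mem_finRange u)⟩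

/-- Two stable matchings agree: at the first online vertex where they differ, each of its two
partners would have to precede the other. -/
theorem IsStable.unique {c : Fin G.numOffline → WithBot ℤ} {M M' : G.EdgeSet}
    (h : G.IsStable c M) (h' : G.IsStable c M') : M = M' := by
  have key : ∀ u v, (u, v) ∈ M ↔ (u, v) ∈ M' := by
    intro u
    induction u using WellFoundedLT.induction with
    | ind u ih =>
      have aux : ∀ {N N' : G.EdgeSet}, G.IsStable c N → G.IsStable c N' →
          (∀ u' < u, ∀ v, (u', v) ∈ N ↔ (u', v) ∈ N') → ∀ v, (u, v) ∈ N → (u, v) ∉ N' →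
          ∃ v', Precedes c v' v ∧ (u, v') ∈ N' := by
        intro N N' hN hN' hi v hv hv'
        rcases hN'.blocked u v (hN.isMatching.1 _ hv) hv' with ⟨u', hlt, hu'⟩ | h
        · exact absurd (hN.isMatching.fst_eq ((hi u' hlt v).2 hu') hv) hlt.ne
        · exact h
      have main : ∀ {N N' : G.EdgeSet}, G.IsStable c N → G.IsStable c N' →
          (∀ u' < u, ∀ v, (u', v) ∈ N ↔ (u', v) ∈ N') → ∀ v, (u, v) ∈ N → (u, v) ∈ N' := by
        intro N N' hN hN' hi v hv
        by_contra hv'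
        obtain ⟨w, hw, hwN⟩ := aux hN hN' hi v hv hv'
        have hwn : (u, w) ∉ N := fun hc => by
          rw [hN.isMatching.snd_eq hc hv] at hwN
          exact hv' hwN
        obtain ⟨x, hx, hxN⟩ := aux hN' hN (fun a ha b => (hi a ha b).symm) w hwN hwn
        rw [hN.isMatching.snd_eq hxN hv] at hx
        exact hx.asymm hw
      exact fun v => ⟨main h h' ih v, main h' h (fun a ha b => (ih a ha b).symm) v⟩
  ext ⟨u, v⟩
  exact key u v

/-- If the order of the offline vertices matched by a stable matching `M` is unchanged in a new
order, then every online vertex matched by `M` is matched by the stable matching `M'` for the new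
order. Otherwise, alternating between `M` and `M'` leads to ever earlier online vertices. -/
theorem IsStable.exists_mem_of_precedes {c c' : Fin G.numOffline → WithBot ℤ} {M M' : G.EdgeSet}
    (h : G.IsStable c M) (h' : G.IsStable c' M')
    (hcc : ∀ u u' v w, (u, v) ∈ M → (u', w) ∈ M → Precedes c v w → Precedes c' v w)
    {u v} (huv : (u, v) ∈ M) : ∃ w, (u, w) ∈ M' := by
  have key : ∀ u v, (u, v) ∈ M → (∀ w, (u, w) ∈ M' → Precedes c' v w) → False := by
    intro u
    induction u using WellFoundedLT.induction with
    | ind u ih =>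
      intro v hv hw
      have hn : (u, v) ∉ M' := fun hc => (hw v hc).asymm (hw v hc)
      rcases h'.blocked u v (h.isMatching.1 _ hv) hn with ⟨u₁, hlt, hu₁⟩ | ⟨v', hp, hv'⟩
      · have hn₁ : (u₁, v) ∉ M := fun hc => hlt.ne (h.isMatching.fst_eq hc hv)
        rcases h.blocked u₁ v (h'.isMatching.1 _ hu₁) hn₁ with ⟨u₂, hlt₂, hu₂⟩ | ⟨v₁, hp, hv₁⟩
        · exact (hlt₂.trans hlt).ne (h.isMatching.fst_eq hu₂ hv)
        · refine ih u₁ hlt v₁ hv₁ fun w hw₁ => ?_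
          rw [h'.isMatching.snd_eq hw₁ hu₁]
          exact hcc _ _ _ _ hv₁ hv hp
      · exact hp.asymm (hw v' hv')
  by_contra hcon
  push Not at hcon
  exact key u v huv fun w hw => absurd hw (hcon w)

/-! ### The matchings of consecutive passes -/

/-- The categories after `k` passes. -/
def category (G : OnlineBipartite) (k : ℕ) : Fin G.numOffline → WithBot ℤ :=
  (G.categoryState k).1

theorem category_zero (v) : G.category 0 v = ⊥ := rfl

theorem category_succ (i : ℕ) (v) : G.category (i + 1) v =
    if G.category i v = ⊥ ∧ ∃ u, (u, v) ∈ G.categoryAdvice (i + 1) then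
      ((-((i : ℤ) + 1) : ℤ) : WithBot ℤ) else G.category i v := rfl

theorem categoryAdvice_zero : G.categoryAdvice 0 = ∅ := rfl

theorem isStable_categoryAdvice (i : ℕ) :
    G.IsStable (G.category i) (G.categoryAdvice (i + 1)) := isStable_ranking _

theorem isMatching_categoryAdvice (i : ℕ) : G.IsMatching (G.categoryAdvice i) := by
  cases i with
  | zero => simp [categoryAdvice_zero, IsMatching]
  | succ i => exact (isStable_categoryAdvice i).isMatching

theorem category_eq_bot_or (i : ℕ) (v) :
    G.category i v = ⊥ ∨ ∃ z : ℤ, G.category i v = z ∧ -(i : ℤ) ≤ z ∧ z ≤ -1 := by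
  induction i with
  | zero => exact Or.inl rfl
  | succ i ih =>
    rw [category_succ]
    split_ifs with h
    · exact Or.inr ⟨_, rfl, by push_cast; omega, by omega⟩
    · rcases ih with h | ⟨z, h, h1, h2⟩
      · exact Or.inl h
      · exact Or.inr ⟨z, h, by push_cast; omega, h2⟩

theorem category_one (v) : G.category 1 v =
    if ∃ u, (u, v) ∈ G.categoryAdvice 1 then ((-1 : ℤ) : WithBot ℤ) else ⊥ := by
  rw [category_succ, category_zero]
  simp

/-- Vertices matched in the first pass keep the category `-1`. -/
theorem category_of_mem_categoryAdvice_one {u v} (h : (u, v) ∈ G.categoryAdvice 1) (i : ℕ) :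
    G.category (i + 1) v = ((-1 : ℤ) : WithBot ℤ) := by
  induction i with
  | zero => rw [zero_add, category_one, if_pos ⟨u, h⟩]
  | succ i ih => rw [category_succ, ih, if_neg (by simp)]

theorem precedes_category_succ {i : ℕ} {v w} {u u'} (hv : (u, v) ∈ G.categoryAdvice (i + 1))
    (hw : (u', w) ∈ G.categoryAdvice (i + 1)) (h : Precedes (G.category i) v w) :
    Precedes (G.category (i + 1)) v w := by
  have hv' : ∃ u, (u, v) ∈ G.categoryAdvice (i + 1) := ⟨u, hv⟩
  have hw' : ∃ u, (u, w) ∈ G.categoryAdvice (i + 1) := ⟨u', hw⟩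
  unfold Precedes at h ⊢
  simp only [category_succ, hv', hw', and_true]
  rcases category_eq_bot_or i v with h1 | ⟨z, h1, h2, h3⟩ <;>
    rcases category_eq_bot_or i w with h4 | ⟨y, h4, h5, h6⟩ <;>
    simp only [h1, h4] at h ⊢ <;> simp_all [WithBot.coe_lt_coe, WithBot.coe_inj]
  rw [← WithBot.coe_add, WithBot.coe_lt_coe]
  exact Or.inl (by omega)

/-- An online vertex that is matched in some pass is matched in all later passes. -/
theorem exists_mem_categoryAdvice_of_le {i j : ℕ} (hij : i ≤ j) {u v}
    (h : (u, v) ∈ G.categoryAdvice i) : ∃ w, (u, w) ∈ G.categoryAdvice j := by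
  induction j, hij using Nat.le_induction with
  | base => exact ⟨v, h⟩
  | succ j _ ih =>
    obtain ⟨w, hw⟩ := ih
    cases j with
    | zero => simp [categoryAdvice_zero] at hw
    | succ j =>
      exact (isStable_categoryAdvice j).exists_mem_of_precedes (isStable_categoryAdvice (j + 1))
        (fun _ _ _ _ => precedes_category_succ) hw

/-! ### Matchings and cardinalities -/

theorem IsMatching.subset {M N : G.EdgeSet} (h : G.IsMatching M) (hN : N ⊆ M) : G.IsMatching N :=
  ⟨fun e he => h.1 e (hN he), fun e he f hf => h.2 e (hN he) f (hN hf)⟩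

theorem IsMatching.card_le_opt {M : G.EdgeSet} (h : G.IsMatching M) : M.card ≤ G.opt :=
  Finset.le_sup (f := Finset.card) (by simp [h])

theorem exists_isMatching_card_eq_opt (G : OnlineBipartite) :
    ∃ M : G.EdgeSet, G.IsMatching M ∧ M.card = G.opt := by
  have hne : (Finset.univ.filter fun M : G.EdgeSet => G.IsMatching M).Nonempty :=
    ⟨∅, by simp [IsMatching]⟩
  obtain ⟨M, hM, h⟩ := Finset.exists_mem_eq_sup _ hne Finset.card
  exact ⟨M, by simpa using hM, h.symm⟩

theorem IsMatching.injOn_fst {M : G.EdgeSet} (h : G.IsMatching M) :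
    Set.InjOn Prod.fst (M : Set (Fin G.numOnline × Fin G.numOffline)) :=
  fun e he f hf hef => h.2 e he f hf (Or.inl hef)

theorem IsMatching.injOn_snd {M : G.EdgeSet} (h : G.IsMatching M) :
    Set.InjOn Prod.snd (M : Set (Fin G.numOnline × Fin G.numOffline)) :=
  fun e he f hf hef => h.2 e he f hf (Or.inr hef)

theorem opt_le_numOnline (G : OnlineBipartite) : G.opt ≤ G.numOnline := by
  obtain ⟨M, hM, h⟩ := exists_isMatching_card_eq_opt G
  rw [← h, ← Finset.card_image_of_injOn hM.injOn_fst]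
  exact (Finset.card_le_univ _).trans (by simp)

theorem opt_le_numOffline (G : OnlineBipartite) : G.opt ≤ G.numOffline := by
  obtain ⟨M, hM, h⟩ := exists_isMatching_card_eq_opt G
  rw [← h, ← Finset.card_image_of_injOn hM.injOn_snd]
  exact (Finset.card_le_univ _).trans (by simp)

/-! ### Embedded graphs -/

/-- The pairs of vertices of `H` that `f` and `g` send to members of `M`. -/
def pullback (M : G.EdgeSet) (f : Fin H.numOnline ↪o Fin G.numOnline)
    (g : Fin H.numOffline ↪o Fin G.numOffline) : H.EdgeSet :=
  Finset.univ.filter fun e => (f e.1, g e.2) ∈ M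

theorem mem_pullback {M : G.EdgeSet} {f : Fin H.numOnline ↪o Fin G.numOnline}
    {g : Fin H.numOffline ↪o Fin G.numOffline} {u v} :
    (u, v) ∈ pullback M f g ↔ (f u, g v) ∈ M := by
  simp [pullback]

theorem card_pullback (M : G.EdgeSet) (f : Fin H.numOnline ↪o Fin G.numOnline)
    (g : Fin H.numOffline ↪o Fin G.numOffline) :
    (pullback M f g).card =
      (M.filter fun e => (∃ u, f u = e.1) ∧ ∃ v, g v = e.2).card := by
  refine Finset.card_bij (fun e _ => (f e.1, g e.2)) ?_ ?_ ?_
  · rintro ⟨u, v⟩ h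
    simpa using mem_pullback.1 h
  · rintro ⟨u, v⟩ - ⟨u', v'⟩ - h
    simpa using h
  · rintro ⟨a, b⟩ h
    obtain ⟨hM, ⟨u, rfl⟩, ⟨v, rfl⟩⟩ := Finset.mem_filter.1 h
    exact ⟨(u, v), mem_pullback.2 hM, rfl⟩

/-- `f` and `g` embed `H` into `G`, respecting the order of arrival and the names, in such a way
that the offline vertices of `H` have no further neighbours in `G`. Images of online vertices may
have further neighbours. -/
def Embeds (f : Fin H.numOnline ↪o Fin G.numOnline) (g : Fin H.numOffline ↪o Fin G.numOffline) :
    Prop :=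
  ∀ u v, g v ∈ G.nbrs u ↔ ∃ u', f u' = u ∧ v ∈ H.nbrs u'

variable {f : Fin H.numOnline ↪o Fin G.numOnline} {g : Fin H.numOffline ↪o Fin G.numOffline}

theorem Embeds.mem_nbrs (h : Embeds f g) {u v} : g v ∈ G.nbrs (f u) ↔ v ∈ H.nbrs u := by
  rw [h]
  simp

/-- Stability passes to an embedded graph, provided that the online vertices of the embedded graph
are not matched better outside it. -/
theorem IsStable.pullback {c : Fin G.numOffline → WithBot ℤ} {c' : Fin H.numOffline → WithBot ℤ}
    {M : G.EdgeSet} (hM : G.IsStable c M) (h : Embeds f g)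
    (hc : ∀ v w, Precedes c (g v) (g w) → Precedes c' v w)
    (hr : ∀ u v w, v ∈ H.nbrs u → (f u, w) ∈ M → Precedes c w (g v) → ∃ x, g x = w) :
    H.IsStable c' (pullback M f g) := by
  refine ⟨⟨?_, ?_⟩, ?_⟩
  · rintro ⟨u, v⟩ he
    exact h.mem_nbrs.1 (hM.isMatching.1 _ (mem_pullback.1 he))
  · rintro ⟨u, v⟩ he ⟨u', v'⟩ he' hee
    have := hM.isMatching.2 _ (mem_pullback.1 he) _ (mem_pullback.1 he')
      (hee.imp (congrArg f) (congrArg g))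
    simpa using this
  · intro u v hv hn
    rcases hM.blocked (f u) (g v) (h.mem_nbrs.2 hv) (fun hc => hn (mem_pullback.2 hc)) with
      ⟨u', hlt, hu'⟩ | ⟨w, hp, hw⟩
    · obtain ⟨a, rfl, -⟩ := (h u' v).1 (hM.isMatching.1 _ hu')
      exact Or.inl ⟨a, by simpa using hlt, mem_pullback.2 hu'⟩
    · obtain ⟨x, rfl⟩ := hr u v w hv hw hp
      exact Or.inr ⟨x, hc _ _ hp, mem_pullback.2 hw⟩

/-- If the neighbours of the embedded online vertices all lie in the embedded graph, then
Category-Advice runs on the embedded graph as it would without the rest of the graph. -/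
theorem Embeds.pullback_categoryAdvice (h : Embeds f g)
    (hr : ∀ u, ∀ w ∈ G.nbrs (f u), ∃ x, g x = w) (i : ℕ) :
    (∀ v, G.category i (g v) = H.category i v) ∧
      pullback (G.categoryAdvice i) f g = H.categoryAdvice i := by
  induction i with
  | zero =>
    refine ⟨fun v => rfl, ?_⟩
    ext ⟨u, v⟩
    simp [mem_pullback, categoryAdvice_zero]
  | succ i ih =>
    have hp : pullback (G.categoryAdvice (i + 1)) f g = H.categoryAdvice (i + 1) := by
      refine IsStable.unique (c := H.category i) ?_ (isStable_categoryAdvice i)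
      refine (isStable_categoryAdvice i).pullback h (fun v w hvw => ?_) fun u v w _ hw _ =>
        hr u w ((isMatching_categoryAdvice _).1 _ hw)
      simpa [Precedes, ih.1] using hvw
    refine ⟨fun v => ?_, hp⟩
    have he : (∃ u, (u, g v) ∈ G.categoryAdvice (i + 1)) ↔
        ∃ u, (u, v) ∈ H.categoryAdvice (i + 1) := by
      rw [← hp]
      constructor
      · rintro ⟨u, hu⟩
        obtain ⟨u', rfl, -⟩ := (h _ _).1 ((isMatching_categoryAdvice _).1 _ hu)
        exact ⟨u', mem_pullback.2 hu⟩
      · rintro ⟨u, hu⟩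
        exact ⟨f u, mem_pullback.1 hu⟩
    simp only [category_succ, ih.1, he]

/-- If the embedded offline vertices are those left unmatched by the first pass, then each later
pass begins with them, and on them it acts like the preceding pass on the embedded graph alone. -/
theorem Embeds.pullback_categoryAdvice_succ (h : Embeds f g)
    (hg : ∀ w, (∃ x, g x = w) ↔ ∀ u, (u, w) ∉ G.categoryAdvice 1) (i : ℕ) :
    (∀ v, G.category (i + 1) (g v) = (H.category i v).map (· - 1)) ∧
      pullback (G.categoryAdvice (i + 1)) f g = H.categoryAdvice i := by
  induction i with
  | zero =>
    refine ⟨fun v => ?_, ?_⟩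
    · rw [zero_add, category_one, if_neg (by push Not; exact (hg _).1 ⟨v, rfl⟩), category_zero]
      rfl
    · ext ⟨u, v⟩
      simp [mem_pullback, categoryAdvice_zero, (hg _).1 ⟨v, rfl⟩]
  | succ i ih =>
    have hp : pullback (G.categoryAdvice (i + 1 + 1)) f g = H.categoryAdvice (i + 1) := by
      refine IsStable.unique (c := H.category i) ?_ (isStable_categoryAdvice i)
      refine (isStable_categoryAdvice (i + 1)).pullback h (fun v w hvw => ?_)
        fun u v w _ _ hw => ?_
      · unfold Precedes at hvw ⊢
        rw [ih.1, ih.1] at hvw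
        rcases category_eq_bot_or i v with h1 | ⟨z, h1, -⟩ <;>
          rcases category_eq_bot_or i w with h2 | ⟨y, h2, -⟩ <;>
          simp only [h1, h2, WithBot.map_bot, WithBot.map_coe, WithBot.coe_lt_coe,
            WithBot.coe_inj, OrderEmbedding.lt_iff_lt, sub_lt_sub_iff_right, sub_left_inj]
            at hvw ⊢ <;> simp_all
      · rw [hg]
        intro u' hu'
        unfold Precedes at hw
        rw [ih.1, category_of_mem_categoryAdvice_one hu'] at hw
        rcases category_eq_bot_or i v with h1 | ⟨z, h1, h2, h3⟩
        · simp [h1] at hw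
        · rw [h1, WithBot.map_coe, WithBot.coe_lt_coe, WithBot.coe_inj] at hw
          omega
    refine ⟨fun v => ?_, hp⟩
    have he : (∃ u, (u, g v) ∈ G.categoryAdvice (i + 1 + 1)) ↔
        ∃ u, (u, v) ∈ H.categoryAdvice (i + 1) := by
      rw [← hp]
      constructor
      · rintro ⟨u, hu⟩
        obtain ⟨u', rfl, -⟩ := (h _ _).1 ((isMatching_categoryAdvice _).1 _ hu)
        exact ⟨u', mem_pullback.2 hu⟩
      · rintro ⟨u, hu⟩
        exact ⟨f u, mem_pullback.1 hu⟩
    rw [category_succ (i + 1) (g v), category_succ i v]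
    simp only [ih.1, he, WithBot.map_eq_bot_iff]
    split_ifs
    · rw [WithBot.map_coe, WithBot.coe_inj]
      push_cast
      ring
    · rfl

/-- When all neighbours of the embedded offline vertices are embedded online vertices, the pullback
of a matching has as many edges as the matching has at embedded offline vertices. -/
theorem Embeds.card_pullback (h : Embeds f g) {M : G.EdgeSet} (hM : G.IsMatching M) :
    (pullback M f g).card = (M.filter fun e => ∃ v, g v = e.2).card := by
  rw [OnlineBipartite.card_pullback]
  congr 1
  refine Finset.filter_congr fun e he => ⟨fun h => h.2, ?_⟩
  rintro ⟨v, hv⟩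
  obtain ⟨u, hu, -⟩ := (h e.1 v).1 (hv ▸ hM.1 e he)
  exact ⟨⟨u, hu⟩, v, hv⟩

theorem Embeds.isMatching_pullback (h : Embeds f g) {M : G.EdgeSet} (hM : G.IsMatching M) :
    H.IsMatching (pullback M f g) := by
  refine ⟨?_, ?_⟩
  · rintro ⟨u, v⟩ he
    exact h.mem_nbrs.1 (hM.1 _ (mem_pullback.1 he))
  · rintro ⟨u, v⟩ he ⟨u', v'⟩ he' hee
    have := hM.2 _ (mem_pullback.1 he) _ (mem_pullback.1 he')
      (hee.imp (congrArg f) (congrArg g))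
    simpa using this

/-! ### The lower bound -/

/-- Every set `S` of offline vertices spans an embedded graph, with all online vertices kept. -/
theorem exists_embeds_range_eq (G : OnlineBipartite) (S : Finset (Fin G.numOffline)) :
    ∃ (H : OnlineBipartite) (f : Fin H.numOnline ↪o Fin G.numOnline)
      (g : Fin H.numOffline ↪o Fin G.numOffline),
      Embeds f g ∧ ∀ w, (∃ x, g x = w) ↔ w ∈ S := by
  refine ⟨⟨G.numOnline, S.card, fun u => Finset.univ.filter fun v =>
    S.orderEmbOfFin rfl v ∈ G.nbrs u⟩, RelEmbedding.refl _, S.orderEmbOfFin rfl, ?_, fun w => ?_⟩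
  · intro u v
    constructor
    · exact fun h => ⟨u, rfl, Finset.mem_filter.2 ⟨Finset.mem_univ _, h⟩⟩
    · rintro ⟨_, rfl, h⟩
      exact (Finset.mem_filter.1 h).2
  · rw [← Finset.mem_coe, ← Finset.range_orderEmbOfFin S rfl]
    rfl

/-- One step of the recursion for the ratio. The online vertices of an optimal matching that stay
unmatched in pass `k + 1` have partners that are matched both in pass `1` and in pass `k + 1`; on
the remaining graph of vertices unmatched in pass `1`, all but the first pass run Category-Advice
with `k` passes. -/
theorem exists_opt_le_card_categoryAdvice_succ (G : OnlineBipartite) (k : ℕ) :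
    ∃ H : OnlineBipartite, G.opt ≤ H.opt + (G.categoryAdvice (k + 1)).card ∧
      G.opt + (H.categoryAdvice k).card ≤ 2 * (G.categoryAdvice (k + 1)).card := by
  classical
  set M := G.categoryAdvice (k + 1)
  have hM : G.IsMatching M := isMatching_categoryAdvice _
  have hM1 : G.IsMatching (G.categoryAdvice 1) := isMatching_categoryAdvice _
  have hle : (G.categoryAdvice 1).card ≤ M.card := by
    rw [← Finset.card_image_of_injOn hM.injOn_fst, ← Finset.card_image_of_injOn hM1.injOn_fst]
    refine Finset.card_le_card fun u hu => ?_
    obtain ⟨⟨a, b⟩, he, rfl⟩ := Finset.mem_image.1 hu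
    obtain ⟨w, hw⟩ := exists_mem_categoryAdvice_of_le (Nat.le_add_left 1 k) he
    exact Finset.mem_image.2 ⟨_, hw, rfl⟩
  obtain ⟨O, hO, hOc⟩ := exists_isMatching_card_eq_opt G
  set S : Finset (Fin G.numOffline) :=
    Finset.univ.filter fun v => ∀ u, (u, v) ∉ G.categoryAdvice 1 with hS
  obtain ⟨H, f, g, hE, hgS⟩ := exists_embeds_range_eq G S
  have hrec := (hE.pullback_categoryAdvice_succ
    (fun w => by rw [hgS]; simp [hS]) k).2
  refine ⟨H, ?_, ?_⟩
  · have h1 := (hE.isMatching_pullback hO).card_le_opt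
    rw [hE.card_pullback hO] at h1
    have h2 : (O.filter fun e => ¬ ∃ v, g v = e.2).card ≤
        (G.categoryAdvice 1).card := by
      rw [← Finset.card_image_of_injOn hM1.injOn_snd,
        ← Finset.card_image_of_injOn (hO.subset (Finset.filter_subset _ _)).injOn_snd]
      refine Finset.card_le_card fun v hv => ?_
      obtain ⟨⟨a, b⟩, he, rfl⟩ := Finset.mem_image.1 hv
      simp only [Finset.mem_filter, hgS] at he
      have := he.2
      simp only [hS, Finset.mem_filter, Finset.mem_univ, true_and, not_forall, not_not] at this
      obtain ⟨u, hu⟩ := this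
      exact Finset.mem_image.2 ⟨_, hu, rfl⟩
    have h3 := Finset.card_filter_add_card_filter_not (s := O)
      (fun e => ∃ v, g v = e.2)
    omega
  · have h1 : (M.filter fun e => ∃ v, g v = e.2).card =
        (H.categoryAdvice k).card := by
      rw [← hE.card_pullback hM, hrec]
    have h2 : (O.filter fun e => ∀ v, (e.1, v) ∉ M).card ≤
        (M.filter fun e => ¬ ∃ v, g v = e.2).card := by
      rw [← Finset.card_image_of_injOn (hO.subset (Finset.filter_subset _ _)).injOn_snd,
        ← Finset.card_image_of_injOn (hM.subset (Finset.filter_subset _ _)).injOn_snd]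
      refine Finset.card_le_card fun v hv => ?_
      obtain ⟨⟨a, b⟩, he, rfl⟩ := Finset.mem_image.1 hv
      simp only [Finset.mem_filter] at he
      have hb := hO.1 _ he.1
      -- An edge at an online vertex that is never matched has its other end matched in each pass.
      have aux : ∀ j ≤ k, ∃ u, (u, b) ∈ G.categoryAdvice (j + 1) := by
        intro j hj
        have hn : ∀ w, (a, w) ∉ G.categoryAdvice (j + 1) := fun w hw => by
          obtain ⟨x, hx⟩ := exists_mem_categoryAdvice_of_le (Nat.succ_le_succ hj) hw
          exact he.2 x hx
        rcases (isStable_categoryAdvice j).blocked a b hb (hn b) with ⟨u, -, hu⟩ | ⟨w, -, hw⟩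
        · exact ⟨u, hu⟩
        · exact absurd hw (hn w)
      obtain ⟨u, hu⟩ := aux k le_rfl
      obtain ⟨u₁, hu₁⟩ := aux 0 (Nat.zero_le k)
      refine Finset.mem_image.2 ⟨(u, b), ?_, rfl⟩
      rw [Finset.mem_filter, hgS]
      refine ⟨hu, fun hbS => ?_⟩
      exact (Finset.mem_filter.1 hbS).2 u₁ hu₁
    have h3 := Finset.card_filter_add_card_filter_not (s := M)
      (fun e => ∃ v, g v = e.2)
    have h4 := Finset.card_filter_add_card_filter_not (s := O) (fun e => ∀ v, (e.1, v) ∉ M)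
    have h5 : (O.filter fun e => ¬ ∀ v, (e.1, v) ∉ M).card ≤ M.card := by
      rw [← Finset.card_image_of_injOn (hO.subset (Finset.filter_subset _ _)).injOn_fst,
        ← Finset.card_image_of_injOn hM.injOn_fst]
      refine Finset.card_le_card fun v hv => ?_
      obtain ⟨e, he, rfl⟩ := Finset.mem_image.1 hv
      have := (Finset.mem_filter.1 he).2
      push Not at this
      obtain ⟨w, hw⟩ := this
      exact Finset.mem_image.2 ⟨_, hw, rfl⟩
    omega

/-- The lower bound on the ratio, with denominators cleared. -/
theorem fib_mul_opt_le (k : ℕ) (G : OnlineBipartite) :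
    Nat.fib (2 * k) * G.opt ≤ Nat.fib (2 * k + 1) * (G.categoryAdvice k).card := by
  induction k generalizing G with
  | zero => simp
  | succ k ih =>
    obtain ⟨H, h1, h2⟩ := exists_opt_le_card_categoryAdvice_succ G k
    have h3 := ih H
    have e1 : Nat.fib (2 * (k + 1)) = Nat.fib (2 * k) + Nat.fib (2 * k + 1) := Nat.fib_add_two
    have e2 : Nat.fib (2 * (k + 1) + 1) = Nat.fib (2 * k + 1) + Nat.fib (2 * (k + 1)) :=
      Nat.fib_add_two
    rw [e2, e1]
    nlinarith [Nat.mul_le_mul_left (Nat.fib (2 * k)) h1,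
      Nat.mul_le_mul_left (Nat.fib (2 * k + 1)) h2]

theorem fib_div_fib_mul_opt_le (k : ℕ) (G : OnlineBipartite) :
    (Nat.fib (2 * k) : ℝ) / (Nat.fib (2 * k + 1) : ℝ) * (G.opt : ℝ) ≤
      ((G.categoryAdvice k).card : ℝ) := by
  have hpos : (0 : ℝ) < Nat.fib (2 * k + 1) := by
    exact_mod_cast Nat.fib_pos.2 (Nat.succ_pos _)
  rw [div_mul_eq_mul_div, div_le_iff₀ hpos, mul_comm (Finset.card _ : ℝ)]
  exact_mod_cast fib_mul_opt_le k G

/-! ### Tight instances -/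

/-- Offline vertices that are all matched before the arrival of `u` number at most as many as the
online vertices that arrive before `u`. -/
theorem IsMatching.card_le_val {M : G.EdgeSet} (hM : G.IsMatching M) {u : Fin G.numOnline}
    {T : Finset (Fin G.numOffline)} (hT : ∀ v ∈ T, ∃ u' < u, (u', v) ∈ M) :
    T.card ≤ u.val := by
  have h1 : T ⊆ (M.filter fun e => e.1 < u).image Prod.snd := fun v hv => by
    obtain ⟨u', h1, h2⟩ := hT v hv
    exact Finset.mem_image.2 ⟨(u', v), Finset.mem_filter.2 ⟨h2, h1⟩, rfl⟩
  have h2 : (M.filter fun e => e.1 < u).image Prod.fst ⊆ Finset.Iio u := fun v hv => by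
    obtain ⟨e, he, rfl⟩ := Finset.mem_image.1 hv
    exact Finset.mem_Iio.2 (Finset.mem_filter.1 he).2
  refine (Finset.card_le_card h1).trans (Finset.card_image_le.trans ?_)
  rw [← Finset.card_image_of_injOn (hM.subset (Finset.filter_subset _ _)).injOn_fst,
    ← Fin.card_Iio]
  exact Finset.card_le_card h2

theorem card_filter_val_lt_of_le {n p : ℕ} (h : p ≤ n) :
    (Finset.univ.filter fun v : Fin n => v.val < p).card = p := by
  rw [Fin.card_filter_val_lt, min_eq_right h]

/-- The graph that turns a tight instance `H` for `k` passes into one for `k + 1` passes. In order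
of arrival, its online vertices are those of `H`, then `q` vertices, then as many vertices as `H`
has online. Its offline vertices are, in order of names, a set `D` as large as the set of online
vertices of `H`, a set `R` of size `q`, and the offline vertices of `H`. Every online vertex is
adjacent to `D`, the middle ones are also adjacent to `R`, and those of `H` to their neighbours in
`H`. The first pass finds only `D` and `R`. Afterwards, the online vertices left free by a run on
`H` take up `D`, until at most `q` of them are busy with `H`. -/
def extend (H : OnlineBipartite) (q : ℕ) : OnlineBipartite where
  numOnline := H.numOnline + q + H.numOnline
  numOffline := H.numOnline + q + H.numOffline
  nbrs u := Finset.univ.filter fun v =>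
    v.val < H.numOnline ∨
    (H.numOnline ≤ u.val ∧ u.val < H.numOnline + q ∧ v.val < H.numOnline + q) ∨
    ∃ u' v', v' ∈ H.nbrs u' ∧ u'.val = u.val ∧ v.val = H.numOnline + q + v'.val

variable {q N : ℕ}

theorem mem_nbrs_extend {u : Fin (H.extend q).numOnline} {v : Fin (H.extend q).numOffline} :
    v ∈ (H.extend q).nbrs u ↔ v.val < H.numOnline ∨
    (H.numOnline ≤ u.val ∧ u.val < H.numOnline + q ∧ v.val < H.numOnline + q) ∨
    ∃ u' v', v' ∈ H.nbrs u' ∧ u'.val = u.val ∧ v.val = H.numOnline + q + v'.val := by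
  exact Finset.mem_filter.trans (and_iff_right (Finset.mem_univ _))

/-- Number of edges of a stable matching of the extended graph, in terms of the number of its edges
inside `H`. -/
theorem IsStable.card_extend {c : Fin (H.extend q).numOffline → WithBot ℤ}
    {M : (H.extend q).EdgeSet} (hM : (H.extend q).IsStable c M)
    (hc : ∀ v w : Fin (H.extend q).numOffline, v.val < H.numOnline → H.numOnline ≤ w.val →
      w.val < H.numOnline + q → Precedes c v w) :
    M.card = H.numOnline + q +
      ((M.filter fun e => H.numOnline + q ≤ e.2.val).card - q) := by
  set p := H.numOnline with hp
  have hmem : ∀ {u v}, (u, v) ∈ M → v ∈ (H.extend q).nbrs u := fun h => hM.isMatching.1 _ h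
  have hoff : p + q ≤ (H.extend q).numOffline := Nat.le_add_right _ _
  have hon : p + q ≤ (H.extend q).numOnline := Nat.le_add_right _ _
  have hcardT : ∀ t ≤ p + q,
      (Finset.univ.filter fun v : Fin (H.extend q).numOffline => v.val < t).card = t :=
    fun t ht => card_filter_val_lt_of_le (ht.trans hoff)
  -- The neighbours of an unmatched vertex are all matched earlier.
  have hfree : ∀ u, (∀ v, (u, v) ∉ M) → ∀ v ∈ (H.extend q).nbrs u, ∃ u' < u, (u', v) ∈ M := by
    intro u hu v hv
    rcases hM.blocked u v hv (hu v) with h | ⟨w, -, hw⟩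
    · exact h
    · exact absurd hw (hu w)
  -- All vertices of the first two groups are matched.
  have hfull : ∀ u : Fin (H.extend q).numOnline, u.val < p + q → ∃ v, (u, v) ∈ M := by
    intro u hu
    by_contra hcon
    push Not at hcon
    by_cases hup : u.val < p
    · have := hM.isMatching.card_le_val (u := u)
        (T := Finset.univ.filter fun v => v.val < p) fun v hv =>
          hfree u hcon v (mem_nbrs_extend.2 (Or.inl (by simpa using hv)))
      rw [hcardT p (by omega)] at this
      omega
    · have := hM.isMatching.card_le_val (u := u)
        (T := Finset.univ.filter fun v => v.val < p + q) fun v hv =>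
          hfree u hcon v (mem_nbrs_extend.2 (Or.inr (Or.inl ⟨by omega, hu, by simpa using hv⟩)))
      rw [hcardT (p + q) le_rfl] at this
      omega
  have hinj1 : ∀ P : Fin (H.extend q).numOnline × Fin (H.extend q).numOffline → Prop,
      [DecidablePred P] → ((M.filter P).image Prod.fst).card = (M.filter P).card := fun P _ =>
    Finset.card_image_of_injOn (hM.isMatching.subset (Finset.filter_subset _ _)).injOn_fst
  have hinj2 : ∀ P : Fin (H.extend q).numOnline × Fin (H.extend q).numOffline → Prop,
      [DecidablePred P] → ((M.filter P).image Prod.snd).card = (M.filter P).card := fun P _ =>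
    Finset.card_image_of_injOn (hM.isMatching.subset (Finset.filter_subset _ _)).injOn_snd
  have h1 : (M.filter fun e => e.1.val < p + q).card = p + q := by
    rw [← hinj1]
    conv_rhs => rw [← card_filter_val_lt_of_le hon]
    congr 1
    ext u
    simp only [Finset.mem_image, Finset.mem_filter, Finset.mem_univ, true_and]
    constructor
    · rintro ⟨e, he, rfl⟩
      exact he.2
    · intro hu
      obtain ⟨v, hv⟩ := hfull u hu
      exact ⟨(u, v), ⟨hv, hu⟩, rfl⟩
  have h2 := Finset.card_filter_add_card_filter_not (s := M) (fun e => e.1.val < p + q)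
  have h3 := Finset.card_filter_add_card_filter_not (s := M) (fun e => p + q ≤ e.2.val)
  have h4 := Finset.card_filter_add_card_filter_not
    (s := M.filter fun e => ¬ p + q ≤ e.2.val) (fun e => e.2.val < p)
  rw [Finset.filter_filter, Finset.filter_filter] at h4
  have hd : (M.filter fun e => ¬ p + q ≤ e.2.val ∧ e.2.val < p).card ≤ p := by
    rw [← hinj2]
    conv_rhs => rw [← hcardT p (by omega)]
    refine Finset.card_le_card fun v hv => ?_
    obtain ⟨e, he, rfl⟩ := Finset.mem_image.1 hv
    simpa using (Finset.mem_filter.1 he).2.2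
  have ha : (M.filter fun e => p + q ≤ e.2.val).card ≤ p := by
    rw [← hinj1]
    conv_rhs => rw [← card_filter_val_lt_of_le
      ((Nat.le_add_right p q).trans hon : p ≤ (H.extend q).numOnline)]
    refine Finset.card_le_card fun u hu => ?_
    obtain ⟨⟨a, b⟩, he, rfl⟩ := Finset.mem_image.1 hu
    obtain ⟨he1, he2⟩ := Finset.mem_filter.1 he
    rcases mem_nbrs_extend.1 (hmem he1) with h | ⟨-, -, h⟩ | ⟨u', v', -, h, -⟩
    · simp only at he2; omega
    · simp only at he2; omega
    · have := u'.2
      exact Finset.mem_filter.2 ⟨Finset.mem_univ _, show a.val < p by omega⟩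
  have hr : (M.filter fun e => ¬ p + q ≤ e.2.val ∧ ¬ e.2.val < p).card ≤ q := by
    have h5 : (Finset.univ.filter fun v : Fin (H.extend q).numOffline => v.val < p + q).card =
        (Finset.univ.filter fun v : Fin (H.extend q).numOffline => v.val < p).card +
        (Finset.univ.filter fun v : Fin (H.extend q).numOffline =>
          ¬ p + q ≤ v.val ∧ ¬ v.val < p).card := by
      rw [← Finset.card_union_of_disjoint]
      · congr 1
        ext v
        simp
        omega
      · rw [Finset.disjoint_filter]
        intros
        omega
    rw [hcardT p (by omega), hcardT (p + q) le_rfl] at h5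
    have h6 : (M.filter fun e => ¬ p + q ≤ e.2.val ∧ ¬ e.2.val < p).card ≤
        (Finset.univ.filter fun v : Fin (H.extend q).numOffline =>
          ¬ p + q ≤ v.val ∧ ¬ v.val < p).card := by
      rw [← hinj2]
      refine Finset.card_le_card fun v hv => ?_
      obtain ⟨e, he, rfl⟩ := Finset.mem_image.1 hv
      simpa using (Finset.mem_filter.1 he).2
    omega
  by_cases hR : ∃ e ∈ M, ¬ p + q ≤ e.2.val ∧ ¬ e.2.val < p
  · -- A middle vertex settled for `R`, so `D` was used up before the last group arrived.
    obtain ⟨⟨u, w⟩, he, hw1, hw2⟩ := hR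
    simp only at hw1 hw2
    have hu : u.val < p + q := by
      rcases mem_nbrs_extend.1 (hmem he) with h | ⟨-, h, -⟩ | ⟨u', v', -, -, h⟩ <;> omega
    have hD : ∀ v : Fin (H.extend q).numOffline, v.val < p → ∃ u' < u, (u', v) ∈ M := by
      intro v hv
      have hvw : v ≠ w := by rintro rfl; exact hw2 hv
      rcases hM.blocked u v (mem_nbrs_extend.2 (Or.inl hv))
        (fun h => hvw (hM.isMatching.snd_eq h he)) with h | ⟨v', h, hv'⟩
      · exact h
      · rw [hM.isMatching.snd_eq hv' he] at h
        exact absurd h (hc v w hv (by omega) (by omega)).asymm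
    have hx : (M.filter fun e => ¬ e.1.val < p + q).card = 0 := by
      rw [Finset.card_eq_zero, Finset.filter_eq_empty_iff]
      rintro ⟨a, b⟩ hab ha'
      simp only at ha'
      rcases mem_nbrs_extend.1 (hmem hab) with h | ⟨-, h, -⟩ | ⟨a', b', -, h, -⟩
      · obtain ⟨u', hlt, hu'⟩ := hD b h
        rw [hM.isMatching.fst_eq hu' hab] at hlt
        have : a.val < u.val := hlt
        omega
      · exact ha' h
      · have := a'.2
        omega
    have hdp : p ≤ (M.filter fun e => ¬ p + q ≤ e.2.val ∧ e.2.val < p).card := by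
      rw [← hinj2]
      conv_lhs => rw [← hcardT p (by omega)]
      refine Finset.card_le_card fun v hv => ?_
      have hv : v.val < p := by simpa using hv
      obtain ⟨u', -, hu'⟩ := hD v hv
      exact Finset.mem_image.2 ⟨(u', v), Finset.mem_filter.2 ⟨hu', by simp only; omega, hv⟩, rfl⟩
    omega
  · have hr0 : (M.filter fun e => ¬ p + q ≤ e.2.val ∧ ¬ e.2.val < p).card = 0 := by
      rw [Finset.card_eq_zero, Finset.filter_eq_empty_iff]
      exact fun e he h => hR ⟨e, he, h⟩
    by_cases hD : ∀ v : Fin (H.extend q).numOffline, v.val < p → ∃ u, (u, v) ∈ M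
    · have hdp : p ≤ (M.filter fun e => ¬ p + q ≤ e.2.val ∧ e.2.val < p).card := by
        rw [← hinj2]
        conv_lhs => rw [← hcardT p (by omega)]
        refine Finset.card_le_card fun v hv => ?_
        have hv : v.val < p := by simpa using hv
        obtain ⟨u', hu'⟩ := hD v hv
        exact Finset.mem_image.2
          ⟨(u', v), Finset.mem_filter.2 ⟨hu', by simp only; omega, hv⟩, rfl⟩
      omega
    · -- An unmatched vertex of `D` forces all online vertices to be matched.
      push Not at hD
      obtain ⟨v, hv, hvn⟩ := hD
      have hall : M.image Prod.fst = Finset.univ := by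
        refine Finset.eq_univ_of_forall fun u => ?_
        by_contra hu
        obtain ⟨u', -, hu'⟩ := hfree u
          (fun w hw => hu (Finset.mem_image.2 ⟨_, hw, rfl⟩)) v (mem_nbrs_extend.2 (Or.inl hv))
        exact hvn u' hu'
      have hcard : M.card = p + q + p := by
        rw [← Finset.card_image_of_injOn hM.isMatching.injOn_fst, hall, Finset.card_univ,
          Fintype.card_fin]
        rfl
      have hd' : (M.filter fun e => ¬ p + q ≤ e.2.val ∧ e.2.val < p).card < p := by
        rw [← hinj2]
        conv_rhs => rw [← hcardT p (by omega)]
        refine Finset.card_lt_card ⟨fun w hw => ?_, fun hsub => ?_⟩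
        · obtain ⟨e, he, rfl⟩ := Finset.mem_image.1 hw
          simpa using (Finset.mem_filter.1 he).2.2
        · obtain ⟨⟨a, b⟩, he, hb⟩ := Finset.mem_image.1
            (hsub (Finset.mem_filter.2 ⟨Finset.mem_univ v, hv⟩))
          simp only at hb
          subst hb
          exact hvn a (Finset.mem_filter.1 he).1
      omega

/-- The embedding of the online vertices of `H` into the extended graph. -/
def extendOnline (H : OnlineBipartite) (q : ℕ) :
    Fin H.numOnline ↪o Fin (H.extend q).numOnline :=
  OrderEmbedding.ofStrictMono
    (fun u => ⟨u, u.2.trans_le ((Nat.le_add_right _ q).trans (Nat.le_add_right _ _))⟩)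
    fun _ _ h => h

/-- The embedding of the offline vertices of `H` into the extended graph. -/
def extendOffline (H : OnlineBipartite) (q : ℕ) :
    Fin H.numOffline ↪o Fin (H.extend q).numOffline :=
  OrderEmbedding.ofStrictMono (fun v => ⟨H.numOnline + q + v, Nat.add_lt_add_left v.2 _⟩)
    fun _ _ h => Nat.add_lt_add_left h _

theorem embeds_extend (H : OnlineBipartite) (q : ℕ) :
    Embeds (extendOnline H q) (extendOffline H q) := by
  intro u v
  have hv : (extendOffline H q v).val = H.numOnline + q + v.val := rfl
  rw [mem_nbrs_extend, hv]
  constructor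
  · rintro (h | ⟨-, -, h⟩ | ⟨u', v', h, hu, hv⟩)
    · omega
    · omega
    · obtain rfl : v = v' := Fin.ext (by omega)
      exact ⟨u', Fin.ext hu, h⟩
  · rintro ⟨u', rfl, h⟩
    exact Or.inr (Or.inr ⟨u', v, h, rfl, rfl⟩)

theorem exists_extendOffline_eq_iff {w : Fin (H.extend q).numOffline} :
    (∃ x, extendOffline H q x = w) ↔ H.numOnline + q ≤ w.val := by
  constructor
  · rintro ⟨x, rfl⟩
    exact Nat.le_add_right _ _
  · intro h
    have : w.val < H.numOnline + q + H.numOffline := w.2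
    exact ⟨⟨w.val - (H.numOnline + q), by omega⟩,
      Fin.ext (show H.numOnline + q + (w.val - (H.numOnline + q)) = w.val by omega)⟩

/-- The first pass on the extended graph matches exactly the offline vertices outside `H`. -/
theorem exists_mem_categoryAdvice_one_extend_iff {w : Fin (H.extend q).numOffline} :
    (∃ u, (u, w) ∈ (H.extend q).categoryAdvice 1) ↔ w.val < H.numOnline + q := by
  have hM := isStable_categoryAdvice (G := H.extend q) 0
  rw [zero_add] at hM
  have hprec : ∀ v w : Fin (H.extend q).numOffline, v < w →
      Precedes ((H.extend q).category 0) v w := fun v w h => Or.inr ⟨rfl, h⟩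
  have hlow : ∀ e ∈ (H.extend q).categoryAdvice 1, e.2.val < H.numOnline + q := by
    rintro ⟨u, v⟩ he
    by_contra hv
    simp only at hv
    have hu : u.val < H.numOnline := by
      rcases mem_nbrs_extend.1 (hM.isMatching.1 _ he) with h | ⟨-, -, h⟩ | ⟨u', v', -, h, -⟩
      · simp only at h; omega
      · simp only at h; omega
      · exact h ▸ u'.2
    -- All of `D` is preferred to `v`, but too few vertices arrive before `u` to use it up.
    have := hM.isMatching.card_le_val (u := u)
      (T := Finset.univ.filter fun v => v.val < H.numOnline) fun w hw => by
        have hw : w.val < H.numOnline := by simpa using hw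
        have hwv : w < v := show w.val < v.val by omega
        rcases hM.blocked u w (mem_nbrs_extend.2 (Or.inl hw))
          (fun h => hwv.ne (hM.isMatching.snd_eq h he)) with h | ⟨v', h, hv'⟩
        · exact h
        · rw [hM.isMatching.snd_eq hv' he] at h
          exact absurd h (hprec _ _ hwv).asymm
    rw [card_filter_val_lt_of_le (n := (H.extend q).numOffline) (p := H.numOnline)
      ((Nat.le_add_right _ q).trans (Nat.le_add_right _ _))] at this
    omega
  have hcard := hM.card_extend fun v w hv hw _ => hprec v w (show v.val < w.val by omega)
  have h0 : ((H.extend q).categoryAdvice 1).filter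
      (fun e => H.numOnline + q ≤ e.2.val) = ∅ := by
    rw [Finset.filter_eq_empty_iff]
    exact fun e he => not_le.2 (hlow e he)
  rw [h0, Finset.card_empty, Nat.zero_sub, add_zero,
    ← Finset.card_image_of_injOn hM.isMatching.injOn_snd] at hcard
  have himg : ((H.extend q).categoryAdvice 1).image Prod.snd =
      Finset.univ.filter fun v => v.val < H.numOnline + q := by
    refine Finset.eq_of_subset_of_card_le (fun v hv => ?_) ?_
    · obtain ⟨e, he, rfl⟩ := Finset.mem_image.1 hv
      simpa using hlow e he
    · rw [hcard, card_filter_val_lt_of_le (n := (H.extend q).numOffline)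
        (p := H.numOnline + q) (Nat.le_add_right _ _)]
  rw [Finset.ext_iff] at himg
  simpa using himg w

/-- In every pass, `D` and `R` share a category and `D` comes first by name, so that
`IsStable.card_extend` applies; the edges inside `H` are those of the preceding pass on `H`. -/
theorem card_categoryAdvice_extend (H : OnlineBipartite) (q i : ℕ) :
    ((H.extend q).categoryAdvice (i + 1)).card =
      H.numOnline + q + ((H.categoryAdvice i).card - q) := by
  have hE := embeds_extend H q
  have h := (hE.pullback_categoryAdvice_succ (fun w => by
    rw [exists_extendOffline_eq_iff, ← not_lt, ← exists_mem_categoryAdvice_one_extend_iff,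
      not_exists]) i).2
  have hM := isStable_categoryAdvice (G := H.extend q) i
  rw [hM.card_extend, ← h, hE.card_pullback hM.isMatching]
  · simp only [exists_extendOffline_eq_iff]
  · intro v w hv hw hwq
    have hvw : v < w := show v.val < w.val by omega
    cases i with
    | zero => exact Or.inr ⟨rfl, hvw⟩
    | succ i =>
      obtain ⟨u, hu⟩ := exists_mem_categoryAdvice_one_extend_iff.2
        (show v.val < H.numOnline + q by omega)
      obtain ⟨u', hu'⟩ := exists_mem_categoryAdvice_one_extend_iff.2 hwq
      refine Or.inr ⟨?_, hvw⟩
      rw [category_of_mem_categoryAdvice_one hu, category_of_mem_categoryAdvice_one hu']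

theorem IsMatching.card_add_le_opt_extend {M : H.EdgeSet} (hM : H.IsMatching M) :
    M.card + (q + H.numOnline) ≤ (H.extend q).opt := by
  have hlt : ∀ j : Fin q, H.numOnline + j.val < (H.extend q).numOnline := fun j => by
    have := j.2; show _ < _ + _ + _; omega
  have hlt' : ∀ j : Fin q, H.numOnline + j.val < (H.extend q).numOffline := fun j => by
    have := j.2; show _ < _ + _ + _; omega
  have hlt2 : ∀ j : Fin H.numOnline, H.numOnline + q + j.val < (H.extend q).numOnline := fun j => by
    have := j.2; show _ < _ + _ + _; omega
  have hlt2' : ∀ j : Fin H.numOnline, j.val < (H.extend q).numOffline := fun j => by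
    have := j.2; show _ < _ + _ + _; omega
  -- The edges of `M`, a perfect matching of the middle vertices with `R`, and one of the last
  -- vertices with `D`.
  let F : (Fin H.numOnline × Fin H.numOffline) ⊕ (Fin q ⊕ Fin H.numOnline) →
      Fin (H.extend q).numOnline × Fin (H.extend q).numOffline :=
    Sum.elim (fun e => (extendOnline H q e.1, extendOffline H q e.2))
      (Sum.elim (fun j => (⟨_, hlt j⟩, ⟨_, hlt' j⟩)) fun j => (⟨_, hlt2 j⟩, ⟨_, hlt2' j⟩))
  have v1 : ∀ u, (extendOnline H q u).val = u.val := fun _ => rfl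
  have v2 : ∀ v, (extendOffline H q v).val = H.numOnline + q + v.val := fun _ => rfl
  have key : ∀ x ∈ M.disjSum Finset.univ, ∀ y ∈ M.disjSum Finset.univ,
      (F x).1 = (F y).1 ∨ (F x).2 = (F y).2 → x = y := by
    rintro (⟨a, b⟩ | i | i) hx (⟨a', b'⟩ | j | j) hy h <;>
      simp only [F, Sum.elim_inl, Sum.elim_inr, Fin.ext_iff, v1, v2] at h
    · have := hM.2 (a, b) (by simpa using hx) (a', b') (by simpa using hy)
        (by simp only [Fin.ext_iff]; omega)
      rw [this]
    · have := a.2; omega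
    · have := a.2; have := j.2; omega
    · have := a'.2; have := i.2; omega
    · congr 2; exact Fin.ext (by omega)
    · have := i.2; have := j.2; omega
    · have := a'.2; have := i.2; omega
    · have := i.2; have := j.2; omega
    · congr 2; exact Fin.ext (by omega)
  have hmatch : (H.extend q).IsMatching ((M.disjSum Finset.univ).image F) := by
    refine ⟨?_, ?_⟩
    · intro e he
      obtain ⟨x, hx, rfl⟩ := Finset.mem_image.1 he
      rw [mem_nbrs_extend]
      rcases x with ⟨a, b⟩ | i | i
      · exact Or.inr (Or.inr ⟨a, b, hM.1 (a, b) (by simpa using hx), rfl, rfl⟩)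
      · exact Or.inr (Or.inl ⟨Nat.le_add_right _ _, Nat.add_lt_add_left i.2 _,
          Nat.add_lt_add_left i.2 _⟩)
      · exact Or.inl i.2
    · intro e he e' he' hee
      obtain ⟨x, hx, rfl⟩ := Finset.mem_image.1 he
      obtain ⟨y, hy, rfl⟩ := Finset.mem_image.1 he'
      rw [key x hx y hy hee]
  have := hmatch.card_le_opt
  rw [Finset.card_image_of_injOn fun x hx y hy h => key x hx y hy (Or.inl (congrArg Prod.fst h)),
    Finset.card_disjSum] at this
  simpa using this

/-- The tight instance for `k` passes: a single edge for `k = 0`, then extended `k` times. -/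
def tight : ℕ → OnlineBipartite
  | 0 => ⟨1, 1, fun _ => Finset.univ⟩
  | k + 1 => (tight k).extend (Nat.fib (2 * k))

theorem tight_spec (k : ℕ) :
    (tight k).numOnline = Nat.fib (2 * k + 1) ∧ (tight k).numOffline = Nat.fib (2 * k + 1) ∧
      (tight k).opt = Nat.fib (2 * k + 1) := by
  induction k with
  | zero =>
    refine ⟨rfl, rfl, le_antisymm (opt_le_numOnline _) ?_⟩
    have : (tight 0).IsMatching Finset.univ :=
      ⟨fun e _ => Finset.mem_univ _, fun e _ f _ _ =>
        Prod.ext (Subsingleton.elim (α := Fin 1) _ _) (Subsingleton.elim (α := Fin 1) _ _)⟩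
    exact this.card_le_opt
  | succ k ih =>
    obtain ⟨h1, h2, h3⟩ := ih
    have e1 : Nat.fib (2 * (k + 1)) = Nat.fib (2 * k) + Nat.fib (2 * k + 1) := Nat.fib_add_two
    have e2 : Nat.fib (2 * (k + 1) + 1) = Nat.fib (2 * k + 1) + Nat.fib (2 * (k + 1)) :=
      Nat.fib_add_two
    have hn : (tight (k + 1)).numOnline = Nat.fib (2 * (k + 1) + 1) := by
      show (tight k).numOnline + _ + (tight k).numOnline = _
      omega
    refine ⟨hn, ?_, le_antisymm (hn ▸ opt_le_numOnline _) ?_⟩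
    · show (tight k).numOnline + _ + (tight k).numOffline = _
      omega
    · obtain ⟨M, hM, hc⟩ := exists_isMatching_card_eq_opt (tight k)
      have : _ ≤ (tight (k + 1)).opt := hM.card_add_le_opt_extend (q := Nat.fib (2 * k))
      omega

theorem card_categoryAdvice_tight (k i : ℕ) :
    ((tight k).categoryAdvice i).card =
      if i = 0 then 0 else if i ≤ k then Nat.fib (2 * k) else Nat.fib (2 * k) + 1 := by
  induction k generalizing i with
  | zero =>
    cases i with
    | zero => rfl
    | succ i =>
      rw [if_neg (Nat.succ_ne_zero i), if_neg (Nat.not_succ_le_zero i), mul_zero, Nat.fib_zero]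
      refine le_antisymm ?_ ?_
      · refine (isMatching_categoryAdvice _).card_le_opt.trans ?_
        exact opt_le_numOnline _
      · by_contra hlt
        have h0 : (tight 0).categoryAdvice (i + 1) = ∅ := by
          rw [← Finset.card_eq_zero]
          omega
        have hM := isStable_categoryAdvice (G := tight 0) i
        rw [h0] at hM
        rcases hM.blocked (0 : Fin 1) (0 : Fin 1) (Finset.mem_univ _) (Finset.notMem_empty _) with
          ⟨_, -, h⟩ | ⟨_, -, h⟩ <;> exact Finset.notMem_empty _ h
  | succ k ih =>
    have e1 : Nat.fib (2 * (k + 1)) = Nat.fib (2 * k) + Nat.fib (2 * k + 1) := Nat.fib_add_two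
    cases i with
    | zero => rfl
    | succ i =>
      have h : ((tight (k + 1)).categoryAdvice (i + 1)).card = _ :=
        card_categoryAdvice_extend (tight k) (Nat.fib (2 * k)) i
      rw [h, ih, (tight_spec k).1, if_neg (Nat.succ_ne_zero i)]
      split_ifs <;> omega

theorem card_categoryAdvice_tight_le (k i : ℕ) :
    ((tight k).categoryAdvice i).card ≤ Nat.fib (2 * k) + 1 := by
  rw [card_categoryAdvice_tight]
  split_ifs <;> omega

/-! ### Disjoint copies -/

/-- The disjoint union of `N` copies of `H`, arriving one after the other. -/
def copies (H : OnlineBipartite) (N : ℕ) : OnlineBipartite where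
  numOnline := N * H.numOnline
  numOffline := N * H.numOffline
  nbrs u := Finset.univ.filter fun v =>
    (finProdFinEquiv.symm u).1 = (finProdFinEquiv.symm v).1 ∧
      (finProdFinEquiv.symm v).2 ∈ H.nbrs (finProdFinEquiv.symm u).2

/-- The embedding of the online vertices of the copy with number `a`. -/
def copyOnline (H : OnlineBipartite) (a : Fin N) :
    Fin H.numOnline ↪o Fin (H.copies N).numOnline :=
  OrderEmbedding.ofStrictMono (fun u => finProdFinEquiv (a, u))
    fun _ _ h => Nat.add_lt_add_right (show _ < _ from h) _

/-- The embedding of the offline vertices of the copy with number `a`. -/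
def copyOffline (H : OnlineBipartite) (a : Fin N) :
    Fin H.numOffline ↪o Fin (H.copies N).numOffline :=
  OrderEmbedding.ofStrictMono (fun u => finProdFinEquiv (a, u))
    fun _ _ h => Nat.add_lt_add_right (show _ < _ from h) _

theorem exists_copyOnline_eq (u : Fin (H.copies N).numOnline) :
    ∃ a x, copyOnline H a x = u :=
  ⟨(finProdFinEquiv.symm u).1, (finProdFinEquiv.symm u).2, finProdFinEquiv.apply_symm_apply u⟩

theorem exists_copyOffline_eq (v : Fin (H.copies N).numOffline) :
    ∃ a x, copyOffline H a x = v :=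
  ⟨(finProdFinEquiv.symm v).1, (finProdFinEquiv.symm v).2, finProdFinEquiv.apply_symm_apply v⟩

theorem copyOnline_eq_iff {a b : Fin N} {u u' : Fin H.numOnline} :
    copyOnline H a u = copyOnline H b u' ↔ a = b ∧ u = u' :=
  finProdFinEquiv.injective.eq_iff.trans Prod.mk_inj

theorem copyOffline_eq_iff {a b : Fin N} {u u' : Fin H.numOffline} :
    copyOffline H a u = copyOffline H b u' ↔ a = b ∧ u = u' :=
  finProdFinEquiv.injective.eq_iff.trans Prod.mk_inj

theorem mem_nbrs_copies {a b : Fin N} {u : Fin H.numOnline} {v : Fin H.numOffline} :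
    copyOffline H b v ∈ (H.copies N).nbrs (copyOnline H a u) ↔ a = b ∧ v ∈ H.nbrs u := by
  refine Finset.mem_filter.trans ((and_iff_right (Finset.mem_univ _)).trans ?_)
  have h1 : finProdFinEquiv.symm (copyOnline H a u) = (a, u) := finProdFinEquiv.symm_apply_apply _
  have h2 : finProdFinEquiv.symm (copyOffline H b v) = (b, v) :=
    finProdFinEquiv.symm_apply_apply _
  rw [h1, h2]

theorem embeds_copies (H : OnlineBipartite) (a : Fin N) :
    Embeds (copyOnline H a) (copyOffline H a) := by
  intro u v
  obtain ⟨b, x, rfl⟩ := exists_copyOnline_eq u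
  rw [mem_nbrs_copies]
  constructor
  · rintro ⟨rfl, h⟩
    exact ⟨x, rfl, h⟩
  · rintro ⟨y, hy, h⟩
    obtain ⟨rfl, rfl⟩ := copyOnline_eq_iff.1 hy
    exact ⟨rfl, h⟩

/-- The union of copies of `M`. -/
def copyEdges (M : H.EdgeSet) (N : ℕ) : (H.copies N).EdgeSet :=
  ((Finset.univ : Finset (Fin N)) ×ˢ M).image fun x =>
    (copyOnline H x.1 x.2.1, copyOffline H x.1 x.2.2)

theorem mem_copyEdges {M : H.EdgeSet} {a b : Fin N} {u v} :
    (copyOnline H a u, copyOffline H b v) ∈ copyEdges M N ↔ a = b ∧ (u, v) ∈ M := by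
  simp only [copyEdges, Finset.mem_image, Finset.mem_product, Finset.mem_univ, true_and,
    Prod.exists, Prod.mk.injEq, copyOnline_eq_iff, copyOffline_eq_iff]
  constructor
  · rintro ⟨c, x, y, h, ⟨rfl, rfl⟩, rfl, rfl⟩
    exact ⟨rfl, h⟩
  · rintro ⟨rfl, h⟩
    exact ⟨a, u, v, h, ⟨rfl, rfl⟩, rfl, rfl⟩

theorem card_copyEdges (M : H.EdgeSet) (N : ℕ) : (copyEdges M N).card = N * M.card := by
  rw [copyEdges, Finset.card_image_of_injective, Finset.card_product, Finset.card_univ,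
    Fintype.card_fin]
  rintro ⟨a, u, v⟩ ⟨b, u', v'⟩ h
  obtain ⟨h1, h2⟩ := Prod.mk_inj.1 h
  obtain ⟨rfl, rfl⟩ := copyOnline_eq_iff.1 h1
  obtain ⟨-, rfl⟩ := copyOffline_eq_iff.1 h2
  rfl

theorem categoryAdvice_copies (H : OnlineBipartite) (N i : ℕ) :
    (H.copies N).categoryAdvice i = copyEdges (H.categoryAdvice i) N := by
  ext ⟨u, v⟩
  obtain ⟨a, u, rfl⟩ := exists_copyOnline_eq u
  obtain ⟨b, v, rfl⟩ := exists_copyOffline_eq v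
  have hp := ((embeds_copies H a).pullback_categoryAdvice (fun x w hw => by
    obtain ⟨c, y, rfl⟩ := exists_copyOffline_eq w
    obtain ⟨rfl, -⟩ := mem_nbrs_copies.1 hw
    exact ⟨y, rfl⟩) i).2
  rw [mem_copyEdges]
  constructor
  · intro h
    obtain ⟨rfl, -⟩ := mem_nbrs_copies.1 ((isMatching_categoryAdvice i).1 _ h)
    rw [← hp, mem_pullback]
    exact ⟨rfl, h⟩
  · rintro ⟨rfl, h⟩
    rwa [← hp, mem_pullback] at h

theorem IsMatching.copyEdges {M : H.EdgeSet} (hM : H.IsMatching M) (N : ℕ) :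
    (H.copies N).IsMatching (copyEdges M N) := by
  refine ⟨?_, ?_⟩
  · rintro ⟨u, v⟩ h
    obtain ⟨a, u, rfl⟩ := exists_copyOnline_eq u
    obtain ⟨b, v, rfl⟩ := exists_copyOffline_eq v
    obtain ⟨rfl, hm⟩ := mem_copyEdges.1 h
    exact mem_nbrs_copies.2 ⟨rfl, hM.1 _ hm⟩
  · rintro ⟨u, v⟩ h ⟨u', v'⟩ h' hee
    obtain ⟨a, u, rfl⟩ := exists_copyOnline_eq u
    obtain ⟨b, v, rfl⟩ := exists_copyOffline_eq v
    obtain ⟨a', u', rfl⟩ := exists_copyOnline_eq u'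
    obtain ⟨b', v', rfl⟩ := exists_copyOffline_eq v'
    obtain ⟨rfl, hm⟩ := mem_copyEdges.1 h
    obtain ⟨rfl, hm'⟩ := mem_copyEdges.1 h'
    simp only [copyOnline_eq_iff, copyOffline_eq_iff, ← and_or_left] at hee
    obtain ⟨rfl, hee⟩ := hee
    obtain ⟨rfl, rfl⟩ := Prod.mk_inj.1 (hM.2 _ hm _ hm' hee)
    rfl

theorem opt_copies_tight (k N : ℕ) :
    ((tight k).copies N).opt = N * Nat.fib (2 * k + 1) := by
  obtain ⟨h1, -, h3⟩ := tight_spec k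
  refine le_antisymm ?_ ?_
  · rw [← h1]
    exact opt_le_numOnline _
  · obtain ⟨M, hM, hc⟩ := exists_isMatching_card_eq_opt (tight k)
    rw [← h3, ← hc, ← card_copyEdges]
    exact (hM.copyEdges N).card_le_opt

end OnlineBipartite

/-! ### Asymptotic ratios -/

section Ratio

open OnlineBipartite Filter

/-- The ratios achieved by `alg` on graphs with optimum at least `N`. -/
def ratios (alg : OnlineBipartite → ℕ) (N : ℕ) : Set ℝ :=
  {r : ℝ | ∃ G : OnlineBipartite, N ≤ G.opt ∧ r = (alg G : ℝ) / (G.opt : ℝ)}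

variable {alg : OnlineBipartite → ℕ}

theorem le_mul_fib (k N : ℕ) : N ≤ N * Nat.fib (2 * k + 1) :=
  Nat.le_mul_of_pos_right _ (Nat.fib_pos.2 (Nat.succ_pos _))

theorem ratios_nonempty (N : ℕ) : (ratios alg N).Nonempty :=
  ⟨_, (tight 0).copies N, by rw [opt_copies_tight]; exact le_mul_fib 0 N, rfl⟩

theorem ratios_bddBelow (N : ℕ) : BddBelow (ratios alg N) := by
  refine ⟨0, ?_⟩
  rintro _ ⟨G, -, rfl⟩
  positivity

/-- The infima that define the asymptotic ratio increase with `N`. If they are bounded, then the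
asymptotic ratio exists. -/
theorem exists_hasAsymptoticRatio {b : ℝ} (hb : ∀ N, sInf (ratios alg N) ≤ b) :
    ∃ ρ ≤ b, HasAsymptoticRatio alg ρ := by
  have hmono : Monotone fun N => sInf (ratios alg N) := by
    intro N N' h
    refine csInf_le_csInf (ratios_bddBelow N) (ratios_nonempty N') ?_
    rintro _ ⟨G, hG, rfl⟩
    exact ⟨G, h.trans hG, rfl⟩
  exact ⟨_, ciSup_le hb, tendsto_atTop_ciSup hmono ⟨b, by rintro _ ⟨N, rfl⟩; exact hb N⟩⟩

theorem HasAsymptoticRatio.le_of_eventually_le {ρ r : ℝ} (h : HasAsymptoticRatio alg ρ) {N₀ : ℕ}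
    (hr : ∀ G : OnlineBipartite, N₀ ≤ G.opt → r * G.opt ≤ alg G) : r ≤ ρ := by
  refine ge_of_tendsto h ?_
  filter_upwards [eventually_ge_atTop (N₀ + 1)] with N hN
  refine le_csInf (ratios_nonempty N) ?_
  rintro _ ⟨G, hG, rfl⟩
  have hpos : (0 : ℝ) < G.opt := by exact_mod_cast (show 0 < G.opt by omega)
  rw [le_div_iff₀ hpos]
  exact hr G (by omega)

theorem hasAsymptoticRatio_categoryAdvice (k : ℕ) (hk : 1 ≤ k) :
    HasAsymptoticRatio (fun G => (G.categoryAdvice k).card)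
      ((Nat.fib (2 * k) : ℝ) / (Nat.fib (2 * k + 1) : ℝ)) := by
  have hle : ∀ N, sInf (ratios (fun G => (G.categoryAdvice k).card) N) ≤
      (Nat.fib (2 * k) : ℝ) / (Nat.fib (2 * k + 1) : ℝ) := by
    intro N
    -- One more copy than needed, as ratios with denominator zero are meaningless.
    refine csInf_le (ratios_bddBelow N) ⟨(tight k).copies (N + 1), ?_, ?_⟩
    · rw [opt_copies_tight]
      exact (Nat.le_succ N).trans (le_mul_fib k _)
    · beta_reduce
      rw [opt_copies_tight, categoryAdvice_copies, card_copyEdges, card_categoryAdvice_tight,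
        if_neg (by omega), if_pos le_rfl]
      push_cast
      rw [mul_div_mul_left _ _ (by positivity)]
  obtain ⟨ρ, hρ, h⟩ := exists_hasAsymptoticRatio hle
  rwa [← le_antisymm hρ (h.le_of_eventually_le (N₀ := 0)
    fun G _ => fib_div_fib_mul_opt_le k G)]

theorem two_div_one_add_sqrt_five : 2 / (1 + Real.sqrt 5) = -Real.goldenConj := by
  rw [← Real.inv_goldenRatio, Real.goldenRatio, inv_div]

theorem tendsto_fib_div_fib :
    Tendsto (fun k : ℕ => (Nat.fib (2 * k) : ℝ) / (Nat.fib (2 * k + 1) : ℝ)) atTop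
      (nhds (2 / (1 + Real.sqrt 5))) := by
  rw [two_div_one_add_sqrt_five]
  exact tendsto_fib_div_fib_succ_atTop.comp
    (tendsto_id.const_mul_atTop' (by norm_num : 0 < 2))

theorem tendsto_fib_add_one_div_fib :
    Tendsto (fun k : ℕ => ((Nat.fib (2 * k) + 1 : ℕ) : ℝ) / (Nat.fib (2 * k + 1) : ℝ)) atTop
      (nhds (2 / (1 + Real.sqrt 5))) := by
  have h0 : Tendsto (fun k : ℕ => 1 / (Nat.fib (2 * k + 1) : ℝ)) atTop (nhds 0) := by
    refine tendsto_const_nhds.div_atTop (tendsto_natCast_atTop_atTop.comp ?_)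
    refine tendsto_atTop_mono' _ ?_ (tendsto_id (x := atTop))
    filter_upwards [eventually_ge_atTop 5] with k hk
    exact (show k ≤ 2 * k + 1 by omega).trans (Nat.le_fib_self (by omega))
  have := tendsto_fib_div_fib.add h0
  rw [add_zero] at this
  refine this.congr fun k => ?_
  push_cast
  ring

/-- Copies of the tight instances bound the ratio for any numbers of passes, as further passes gain
at most one vertex per copy. -/
theorem sInf_ratios_categoryAdvice_le (κ : ℕ → ℕ → ℕ) (N : ℕ) :
    sInf (ratios (fun G => (G.categoryAdvice (κ G.numOnline G.numOffline)).card) N) ≤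
      2 / (1 + Real.sqrt 5) := by
  refine ge_of_tendsto' tendsto_fib_add_one_div_fib fun k => ?_
  refine (csInf_le (ratios_bddBelow N) ⟨(tight k).copies (N + 1), ?_, rfl⟩).trans ?_
  · rw [opt_copies_tight]
    exact (Nat.le_succ N).trans (le_mul_fib k _)
  · rw [opt_copies_tight, categoryAdvice_copies, card_copyEdges]
    push_cast
    rw [mul_div_mul_left _ _ (by positivity)]
    gcongr
    exact_mod_cast card_categoryAdvice_tight_le k _

/-- An instance of Cassini's identity. -/
theorem fib_sq_eq (k : ℕ) : Nat.fib (2 * k + 1) ^ 2 =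
    Nat.fib (2 * k) * Nat.fib (2 * k + 1) + Nat.fib (2 * k) ^ 2 + 1 := by
  induction k with
  | zero => rfl
  | succ k ih =>
    have e1 : Nat.fib (2 * (k + 1)) = Nat.fib (2 * k) + Nat.fib (2 * k + 1) := Nat.fib_add_two
    have e2 : Nat.fib (2 * (k + 1) + 1) = Nat.fib (2 * k + 1) + Nat.fib (2 * (k + 1)) :=
      Nat.fib_add_two
    rw [e2, e1]
    linarith

theorem monotone_fib_div_fib :
    Monotone fun k : ℕ => (Nat.fib (2 * k) : ℝ) / (Nat.fib (2 * k + 1) : ℝ) := by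
  refine monotone_nat_of_le_succ fun k => ?_
  have e1 : Nat.fib (2 * (k + 1)) = Nat.fib (2 * k) + Nat.fib (2 * k + 1) := Nat.fib_add_two
  have e2 : Nat.fib (2 * (k + 1) + 1) = Nat.fib (2 * k + 1) + Nat.fib (2 * (k + 1)) :=
    Nat.fib_add_two
  have hpos : (0 : ℝ) < Nat.fib (2 * k + 1) := by
    exact_mod_cast Nat.fib_pos.2 (Nat.succ_pos _)
  have h0 : (0 : ℝ) ≤ Nat.fib (2 * k) := Nat.cast_nonneg _
  have hsq : (Nat.fib (2 * k + 1) : ℝ) ^ 2 =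
      Nat.fib (2 * k) * Nat.fib (2 * k + 1) + Nat.fib (2 * k) ^ 2 + 1 := by
    exact_mod_cast fib_sq_eq k
  rw [e2, e1]
  push_cast
  rw [div_le_div_iff₀ hpos (by linarith)]
  linarith

theorem HasAsymptoticRatio.eq_of_tendsto {κ : ℕ → ℕ → ℕ} {ρ : ℝ}
    (hρ : HasAsymptoticRatio
      (fun G => (G.categoryAdvice (κ G.numOnline G.numOffline)).card) ρ)
    (hle : ρ ≤ 2 / (1 + Real.sqrt 5))
    (hκ : Tendsto (fun p : ℕ × ℕ => κ p.1 p.2) (atTop ×ˢ atTop) atTop) :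
    ρ = 2 / (1 + Real.sqrt 5) := by
  refine le_antisymm hle (le_of_tendsto' tendsto_fib_div_fib fun k => ?_)
  have hev := (tendsto_atTop.1 hκ) k
  rw [prod_atTop_atTop_eq] at hev
  obtain ⟨⟨a, b⟩, hab⟩ := eventually_atTop.1 hev
  refine hρ.le_of_eventually_le (N₀ := a + b) fun G hG => ?_
  have h1 := opt_le_numOnline G
  have h2 := opt_le_numOffline G
  refine le_trans ?_ (fib_div_fib_mul_opt_le _ G)
  gcongr ?_ * _
  exact monotone_fib_div_fib
    (hab (G.numOnline, G.numOffline) ⟨show a ≤ _ by omega, show b ≤ _ by omega⟩)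

end Ratio

/-! ### Memory of the streaming algorithm -/

namespace CategoryStream

/-- Memory content: the entries in unary, each followed by a terminating `false`. -/
def write (l : List ℕ) : List Bool :=
  l.flatMap fun x => (List.range x).map (fun _ => true) ++ [false]

/-- The entries stored in the memory. -/
def read (m : List Bool) : List ℕ :=
  m.foldr (fun b l => if b = true then (l.headI + 1) :: l.tail else 0 :: l) []

theorem write_cons (x : ℕ) (l : List ℕ) :
    write (x :: l) = List.replicate x true ++ false :: write l := by
  simp [write]

theorem read_write (l : List ℕ) : read (write l) = l := by
  induction l with
  | nil => rfl
  | cons x l ih =>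
    rw [write_cons]
    induction x with
    | zero =>
      change 0 :: read (write l) = _
      rw [ih]
    | succ x ihx =>
      rw [List.replicate_succ, List.cons_append]
      change ((read (List.replicate x true ++ false :: write l)).headI + 1) ::
        (read (List.replicate x true ++ false :: write l)).tail = _
      rw [ihx]
      rfl

theorem length_write_le {l : List ℕ} {b : ℕ} (h : ∀ x ∈ l, x < b) :
    (write l).length ≤ b * l.length := by
  induction l with
  | nil => simp [write]
  | cons x l ih =>
    have h1 := ih fun y hy => h y (List.mem_cons_of_mem _ hy)
    have h2 := h x List.mem_cons_self
    have h3 : (write (x :: l)).length = x + 1 + (write l).length := by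
      rw [write_cons, List.length_append, List.length_cons, List.length_replicate]
      omega
    rw [h3, List.length_cons, Nat.mul_succ]
    omega

/-- Vertex `v` is a neighbour of the current online vertex, and it is not yet matched in this
pass. The entry of `v` is `4 * a + 2 * b + s`, where the age `a` counts the passes since the first
one that matched `v`, inclusively (`0` if there is none), and the bits `b` and `s` tell whether `v`
is matched in the current pass and whether it is adjacent to the current online vertex. -/
def IsFree (l : List ℕ) (v : ℕ) : Prop := l.getD v 0 % 4 = 1

instance (l : List ℕ) (v : ℕ) : Decidable (IsFree l v) := by unfold IsFree; infer_instance

/-- Vertex `v` is free and of minimal age among the free vertices below `n`. -/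
def IsYoungest (n : ℕ) (l : List ℕ) (v : ℕ) : Prop :=
  IsFree l v ∧ ∀ w ∈ List.range n, ¬ IsFree l w ∨ l.getD v 0 / 4 ≤ l.getD w 0 / 4

instance (n : ℕ) (l : List ℕ) (v : ℕ) : Decidable (IsYoungest n l v) := by
  unfold IsYoungest; infer_instance

/-- The choice of Ranking for the current online vertex. -/
def pick (n : ℕ) (l : List ℕ) : Option ℕ :=
  ((List.range n).filter fun v => IsYoungest n l v).head?

/-- Reaction to a neighbour `v` of the current online vertex. -/
def onNeighbour (n : ℕ) (l : List ℕ) (v : ℕ) : List ℕ :=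
  (List.range n).map fun i =>
    if i = v ∧ l.getD i 0 % 2 = 0 then l.getD i 0 + 1 else l.getD i 0

/-- Reaction to the end of a list of neighbours. -/
def onEndOfVertex (n : ℕ) (l : List ℕ) : List ℕ :=
  (List.range n).map fun i =>
    if pick n l = some i then 4 * (l.getD i 0 / 4) + 2 else 2 * (l.getD i 0 / 2)

/-- Reaction to the end of a pass. -/
def onEndOfPass (n : ℕ) (l : List ℕ) : List ℕ :=
  (List.range n).map fun i => if l.getD i 0 / 2 = 0 then 0 else 4 * (l.getD i 0 / 4 + 1)

/-- The transition rule. -/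
def step (n : ℕ) (m : List Bool) (t : StreamToken) : List Bool × Option ℕ :=
  Option.casesOn t (write (onEndOfPass n (read m)), none) fun t' =>
    Option.casesOn t' (write (onEndOfVertex n (read m)), pick n (read m)) fun v =>
      (write (onNeighbour n (read m) v), none)

/-! ### Computability of the transition rule -/

section Computability

open Primrec

theorem primrec_write : Primrec write := by
  refine list_flatMap Primrec.id ?_
  exact list_append.comp₂ (list_map (list_range.comp Primrec.snd) (Primrec.const true).to₂).to₂
    (Primrec.const [false]).to₂

theorem primrec_read : Primrec read := by
  refine list_foldr (h := fun _ (p : Bool × List ℕ) =>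
    if p.1 = true then (p.2.headI + 1) :: p.2.tail else 0 :: p.2)
    Primrec.id (Primrec.const []) ?_
  have hb : Primrec fun x : List Bool × Bool × List ℕ => x.2.1 := Primrec.fst.comp Primrec.snd
  have hl : Primrec fun x : List Bool × Bool × List ℕ => x.2.2 := Primrec.snd.comp Primrec.snd
  exact Primrec.ite (Primrec.eq.comp hb (Primrec.const true))
    (list_cons.comp (Primrec.succ.comp (list_headI.comp hl)) (list_tail.comp hl))
    (list_cons.comp (Primrec.const 0) hl)

theorem primrecRel_isFree : PrimrecRel IsFree := by
  unfold IsFree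
  exact Primrec.eq.comp (nat_mod.comp ((list_getD 0).comp Primrec.fst Primrec.snd)
    (Primrec.const 4)) (Primrec.const 1)

theorem primrecPred_isYoungest :
    PrimrecPred fun p : (ℕ × List ℕ) × ℕ => IsYoungest p.1.1 p.1.2 p.2 := by
  have hn : Primrec fun p : (ℕ × List ℕ) × ℕ => p.1.1 := Primrec.fst.comp Primrec.fst
  have hl : Primrec fun p : (ℕ × List ℕ) × ℕ => p.1.2 := Primrec.snd.comp Primrec.fst
  have hR : PrimrecRel fun (w : ℕ) (p : (ℕ × List ℕ) × ℕ) =>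
      ¬ IsFree p.1.2 w ∨ p.1.2.getD p.2 0 / 4 ≤ p.1.2.getD w 0 / 4 := by
    have hl' : Primrec fun x : ℕ × (ℕ × List ℕ) × ℕ => x.2.1.2 := hl.comp Primrec.snd
    refine PrimrecPred.or (PrimrecPred.not (primrecRel_isFree.comp hl' Primrec.fst)) ?_
    exact nat_le.comp
      (nat_div.comp ((list_getD 0).comp hl' (Primrec.snd.comp Primrec.snd)) (Primrec.const 4))
      (nat_div.comp ((list_getD 0).comp hl' Primrec.fst) (Primrec.const 4))
  exact (primrecRel_isFree.comp hl Primrec.snd).and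
    (hR.forall_mem_list.comp (list_range.comp hn) Primrec.id)

theorem primrec_pick : Primrec₂ pick := by
  have h : Primrec fun p : ℕ × List ℕ => (List.range p.1).filterMap fun v =>
      if IsYoungest p.1 p.2 v then some v else none :=
    listFilterMap (list_range.comp Primrec.fst)
      (Primrec.ite primrecPred_isYoungest (option_some.comp Primrec.snd) (Primrec.const none))
  refine (list_head?.comp h).of_eq fun p => ?_
  rw [pick, ← List.filterMap_eq_filter]
  congr 2
  funext v
  simp [Option.guard]

theorem primrec_onEndOfPass : Primrec₂ onEndOfPass := by
  refine list_map (list_range.comp Primrec.fst) ?_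
  have hx : Primrec fun x : (ℕ × List ℕ) × ℕ => x.1.2.getD x.2 0 :=
    (list_getD 0).comp (Primrec.snd.comp Primrec.fst) Primrec.snd
  exact Primrec.ite
    (Primrec.eq.comp (nat_div.comp hx (Primrec.const 2)) (Primrec.const 0)) (Primrec.const 0)
    (nat_mul.comp (Primrec.const 4) (Primrec.succ.comp (nat_div.comp hx (Primrec.const 4))))

theorem primrec_onEndOfVertex : Primrec₂ onEndOfVertex := by
  refine list_map (list_range.comp Primrec.fst) ?_
  have hx : Primrec fun x : (ℕ × List ℕ) × ℕ => x.1.2.getD x.2 0 :=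
    (list_getD 0).comp (Primrec.snd.comp Primrec.fst) Primrec.snd
  exact Primrec.ite
    (Primrec.eq.comp
      (primrec_pick.comp (Primrec.fst.comp Primrec.fst) (Primrec.snd.comp Primrec.fst))
      (option_some.comp Primrec.snd))
    (nat_add.comp (nat_mul.comp (Primrec.const 4) (nat_div.comp hx (Primrec.const 4)))
      (Primrec.const 2))
    (nat_mul.comp (Primrec.const 2) (nat_div.comp hx (Primrec.const 2)))

theorem primrec_onNeighbour :
    Primrec fun p : (ℕ × List ℕ) × ℕ => onNeighbour p.1.1 p.1.2 p.2 := by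
  refine list_map (list_range.comp (Primrec.fst.comp Primrec.fst)) ?_
  have hx : Primrec fun x : ((ℕ × List ℕ) × ℕ) × ℕ => x.1.1.2.getD x.2 0 :=
    (list_getD 0).comp (Primrec.snd.comp (Primrec.fst.comp Primrec.fst)) Primrec.snd
  exact Primrec.ite
    ((Primrec.eq.comp Primrec.snd (Primrec.snd.comp Primrec.fst)).and
      (Primrec.eq.comp (nat_mod.comp hx (Primrec.const 2)) (Primrec.const 0)))
    (Primrec.succ.comp hx) hx

theorem primrec_step :
    Primrec fun p : ℕ × List Bool × StreamToken => step p.1 p.2.1 p.2.2 := by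
  have hl : Primrec fun p : ℕ × List Bool × StreamToken => read p.2.1 :=
    primrec_read.comp (Primrec.fst.comp Primrec.snd)
  refine option_casesOn (Primrec.snd.comp Primrec.snd)
    (Primrec.pair (primrec_write.comp (primrec_onEndOfPass.comp Primrec.fst hl))
      (Primrec.const none)) ?_
  have hn' : Primrec fun p : (ℕ × List Bool × StreamToken) × Option ℕ => p.1.1 :=
    Primrec.fst.comp Primrec.fst
  have hl' : Primrec fun p : (ℕ × List Bool × StreamToken) × Option ℕ => read p.1.2.1 :=
    hl.comp Primrec.fst
  refine option_casesOn Primrec.snd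
    (Primrec.pair (primrec_write.comp (primrec_onEndOfVertex.comp hn' hl'))
      (primrec_pick.comp hn' hl')) ?_
  exact Primrec.pair
    (primrec_write.comp (primrec_onNeighbour.comp
      (Primrec.pair (Primrec.pair (hn'.comp Primrec.fst) (hl'.comp Primrec.fst)) Primrec.snd)))
    (Primrec.const none)

end Computability

/-- The semi-streaming implementation of Category-Advice. The number of passes need not be stored,
because sorting by category is sorting by age. -/
def algorithm : StreamingAlgorithm where
  init n := write ((List.range n).map fun _ => 0)
  step := step
  computable_init := (primrec_write.comp
    (Primrec.list_map Primrec.list_range (Primrec.const 0).to₂)).to_comp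
  computable_step := primrec_step.to_comp

/-! ### Space -/

theorem getD_lt {l : List ℕ} {b : ℕ} (hb : 0 < b) (h : ∀ x ∈ l, x < b) (i : ℕ) :
    l.getD i 0 < b := by
  rw [List.getD_eq_getElem?_getD]
  rcases hi : l[i]? with _ | x
  · simpa
  · exact h x (List.mem_of_getElem? hi)

/-- Ages grow only at the end of a pass. -/
theorem exists_memory_eq (n : ℕ) (ts : List StreamToken) :
    ∃ l : List ℕ, algorithm.memory n ts = write l ∧ l.length = n ∧
      ∀ x ∈ l, x < 4 * (ts.count none + 1) := by
  induction ts using List.reverseRecOn with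
  | nil =>
    refine ⟨(List.range n).map fun _ => 0, rfl, by simp, fun x hx => ?_⟩
    simp at hx
    simp [hx.2]
  | append_singleton ts t ih =>
    obtain ⟨l, h1, h2, h3⟩ := ih
    have hs : algorithm.memory n (ts ++ [t]) = (step n (write l) t).1 := by
      rw [← h1]
      simp [StreamingAlgorithm.memory, algorithm]
    have hg := getD_lt (by omega) h3
    rw [hs, List.count_append]
    rcases t with _ | _ | v
    · refine ⟨onEndOfPass n l, by simp [step, read_write], by simp [onEndOfPass], ?_⟩
      simp only [onEndOfPass, List.mem_map, List.count_singleton_self]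
      rintro _ ⟨i, -, rfl⟩
      have := hg i
      split_ifs <;> omega
    · refine ⟨onEndOfVertex n l, by simp [step, read_write], by simp [onEndOfVertex], ?_⟩
      simp only [onEndOfVertex, List.mem_map]
      rintro _ ⟨i, -, rfl⟩
      have := hg i
      split_ifs <;> omega
    · refine ⟨onNeighbour n l v, by simp [step, read_write], by simp [onNeighbour], ?_⟩
      simp only [onNeighbour, List.mem_map]
      rintro _ ⟨i, -, rfl⟩
      have := hg i
      split_ifs <;> omega

theorem count_passTokens (G : OnlineBipartite)
    (L : Fin G.numOnline → List (Fin G.numOffline)) : (G.passTokens L).count none = 1 := by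
  rw [OnlineBipartite.passTokens, List.count_append, List.count_singleton_self,
    List.count_eq_zero.2]
  simp

theorem usesLinearSpace (k : ℕ) : algorithm.UsesLinearSpace k (4 * (k + 1)) := by
  intro G L _ ts hts
  obtain ⟨l, h1, h2, h3⟩ := exists_memory_eq G.numOffline ts
  have hc : ts.count none ≤ k := by
    refine (hts.sublist.count_le none).trans (le_of_eq ?_)
    rw [List.count_flatten, List.map_replicate, count_passTokens, List.sum_replicate]
    simp
  rw [h1]
  refine (length_write_le (b := 4 * (k + 1)) fun x hx => (h3 x hx).trans_le (by omega)).trans ?_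
  rw [h2]
  exact Nat.mul_le_mul_left _ (Nat.le_succ _)

/-! ### Correctness of the streaming algorithm -/

open OnlineBipartite

variable {G : OnlineBipartite}

/-- The number of passes among the first `i`, counted from the first one that matched `v`,
inclusively. -/
def age (G : OnlineBipartite) : ℕ → Fin G.numOffline → ℕ
  | 0, _ => 0
  | i + 1, v =>
    if age G i v = 0 ∧ ¬ ∃ u, (u, v) ∈ G.categoryAdvice (i + 1) then 0 else age G i v + 1

/-- Vertices of category `-t` have age `i + 1 - t` after `i` passes. -/
theorem category_and_age (i : ℕ) (v) :
    (G.category i v = ⊥ ∧ age G i v = 0) ∨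
      ∃ z : ℤ, G.category i v = z ∧ (age G i v : ℤ) = i + 1 + z ∧ -(i : ℤ) ≤ z := by
  induction i with
  | zero => exact Or.inl ⟨rfl, rfl⟩
  | succ i ih =>
    rw [category_succ, age]
    rcases ih with ⟨h1, h2⟩ | ⟨z, h1, h2, h3⟩
    · by_cases hm : ∃ u, (u, v) ∈ G.categoryAdvice (i + 1)
      · right
        refine ⟨-((i : ℤ) + 1), ?_, ?_, ?_⟩
        · rw [if_pos ⟨h1, hm⟩]
        · rw [if_neg (by tauto), h2]
          push_cast
          ring
        · push_cast
          exact le_rfl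
      · left
        rw [if_neg (by tauto), if_pos ⟨h2, hm⟩]
        exact ⟨h1, rfl⟩
    · right
      refine ⟨z, ?_, ?_, by push_cast; omega⟩
      · rw [if_neg (by simp [h1]), h1]
      · rw [if_neg (by omega)]
        push_cast
        omega

theorem precedes_category_iff (i : ℕ) (v w) : Precedes (G.category i) v w ↔
    age G i v < age G i w ∨ (age G i v = age G i w ∧ v < w) := by
  unfold Precedes
  rcases category_and_age i v with ⟨h1, h2⟩ | ⟨z, h1, h2, h3⟩ <;>
    rcases category_and_age i w with ⟨h4, h5⟩ | ⟨y, h4, h5, h6⟩ <;> rw [h1, h4]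
  · simp [h2, h5]
  · have h : age G i v < age G i w := by omega
    simp [h]
  · have h : ¬ age G i v < age G i w := by omega
    have h' : ¬ age G i v = age G i w := by omega
    simp [h, h']
  · rw [WithBot.coe_lt_coe, WithBot.coe_inj]
    have h : z < y ↔ age G i v < age G i w := by omega
    have h' : z = y ↔ age G i v = age G i w := by omega
    rw [h, h']

open Classical in
/-- The entry of `v` after `i` passes, when `M` is the matching found so far in the current pass and
`S` is the set of those neighbours of the current online vertex that have been listed. -/
noncomputable def entry (i : ℕ) (M : G.EdgeSet) (S : Finset (Fin G.numOffline))
    (v : Fin G.numOffline) : ℕ :=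
  4 * age G i v + (if ∃ u, (u, v) ∈ M then 2 else 0) + if v ∈ S then 1 else 0

/-- The list of all entries. -/
noncomputable def entries (i : ℕ) (M : G.EdgeSet) (S : Finset (Fin G.numOffline)) : List ℕ :=
  List.ofFn (entry i M S)

theorem getD_entries (i : ℕ) (M : G.EdgeSet) (S : Finset (Fin G.numOffline)) (v) :
    (entries i M S).getD v.val 0 = entry i M S v := by
  simp [entries, List.getD_eq_getElem?_getD]

theorem map_range_eq_ofFn {n : ℕ} {h : ℕ → ℕ} {e : Fin n → ℕ} (he : ∀ v : Fin n, h v = e v) :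
    (List.range n).map h = List.ofFn e := by
  refine List.ext_getElem (by simp) fun j h1 h2 => ?_
  have hj : j < n := by simpa using h1
  simpa using he ⟨j, hj⟩

theorem onNeighbour_entries (i : ℕ) (M : G.EdgeSet) (S : Finset (Fin G.numOffline)) (v) :
    onNeighbour G.numOffline (entries i M S) v.val = entries i M (insert v S) := by
  refine map_range_eq_ofFn fun w => ?_
  simp only [getD_entries, ← Fin.ext_iff]
  unfold entry
  by_cases hw : w = v
  · subst hw
    by_cases hS : w ∈ S <;> by_cases hM : ∃ u, (u, w) ∈ M <;> simp [hS, hM] <;> omega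
  · simp [hw]

theorem onEndOfPass_entries (i : ℕ) :
    onEndOfPass G.numOffline (entries i (G.categoryAdvice (i + 1)) ∅) =
      entries (G := G) (i + 1) ∅ ∅ := by
  refine map_range_eq_ofFn fun w => ?_
  rw [getD_entries]
  simp only [entry, age, Finset.notMem_empty, exists_false, if_false, add_zero]
  by_cases hm : ∃ u, (u, w) ∈ G.categoryAdvice (i + 1)
  · simp only [hm, if_true, not_true_eq_false, and_false, if_false]
    split_ifs <;> omega
  · simp only [hm, if_false, not_false_eq_true, and_true]
    split_ifs <;> omega

theorem isFree_entries_iff {i : ℕ} {M : G.EdgeSet} {S : Finset (Fin G.numOffline)} {v} :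
    IsFree (entries i M S) v.val ↔ v ∈ S ∧ ∀ u, (u, v) ∉ M := by
  rw [IsFree, getD_entries, entry]
  by_cases hS : v ∈ S <;> by_cases hM : ∃ u, (u, v) ∈ M
  · simp only [hS, hM, if_true, true_and]
    have : ¬ ∀ u, (u, v) ∉ M := by push Not; exact hM
    simp only [this, iff_false]
    omega
  · simp only [hS, hM, if_true, if_false, true_and]
    have : ∀ u, (u, v) ∉ M := by push Not at hM; exact hM
    simp only [this, not_false_eq_true, implies_true, iff_true]
    omega
  · simp only [hS, hM, if_true, if_false, false_and, iff_false]
    omega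
  · simp only [hS, hM, if_false, false_and, iff_false]
    omega

theorem entry_div_four (i : ℕ) (M : G.EdgeSet) (S : Finset (Fin G.numOffline)) (v) :
    entry i M S v / 4 = age G i v := by
  unfold entry
  split_ifs <;> omega

theorem isYoungest_entries_iff {i : ℕ} {M : G.EdgeSet} {u v} :
    IsYoungest G.numOffline (entries i M (G.nbrs u)) v.val ↔
      v ∈ G.available M u ∧ ∀ w ∈ G.available M u, age G i v ≤ age G i w := by
  rw [IsYoungest, isFree_entries_iff, ← mem_available]
  refine and_congr_right fun _ => ⟨fun h w hw => ?_, fun h w hw => ?_⟩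
  · have := h w.val (List.mem_range.2 w.2)
    rw [getD_entries, getD_entries, entry_div_four, entry_div_four, isFree_entries_iff,
      ← mem_available] at this
    tauto
  · rw [List.mem_range] at hw
    have := h ⟨w, hw⟩
    have hw' : w = (⟨w, hw⟩ : Fin G.numOffline).val := rfl
    rw [hw', getD_entries, getD_entries, entry_div_four, entry_div_four, isFree_entries_iff,
      ← mem_available]
    tauto

/-- The algorithm picks the vertex that Ranking picks. -/
theorem exists_pick_entries (i : ℕ) (M : G.EdgeSet) (u : Fin G.numOnline) :
    ∃ o : Option (Fin G.numOffline),
      pick G.numOffline (entries i M (G.nbrs u)) = o.map Fin.val ∧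
      (∀ a v, (a, v) ∈ G.rankingStep (categoryPerm (G.category i)) M u ↔
        (a, v) ∈ M ∨ (a = u ∧ o = some v)) := by
  rw [pick, List.head?_filter]
  rcases rankingStep_cases (categoryPerm (G.category i)) M u with ⟨h0, h⟩ | ⟨v, hv, hmin, h⟩
  · refine ⟨none, ?_, fun a v => by simp [h]⟩
    rw [Option.map_none, List.find?_eq_none]
    intro x hx
    rw [List.mem_range] at hx
    have := isYoungest_entries_iff (i := i) (M := M) (u := u) (v := ⟨x, hx⟩)
    simp only [h0, Finset.notMem_empty, false_and, iff_false] at this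
    simpa using this
  · have hprec : ∀ w ∈ G.available M u, ¬ Precedes (G.category i) w v := fun w hw => by
      rw [Precedes, ← categoryPerm_lt_iff]
      exact not_lt.2 (hmin w hw)
    simp only [precedes_category_iff, not_or, not_lt, not_and] at hprec
    refine ⟨some v, ?_, fun a w => ?_⟩
    · rw [Option.map_some, List.find?_range_eq_some]
      refine ⟨?_, List.mem_range.2 v.2, fun j hj => ?_⟩
      · simp only [decide_eq_true_eq]
        exact isYoungest_entries_iff.2 ⟨hv, fun w hw => (hprec w hw).1⟩
      · have hj' : j < G.numOffline := hj.trans v.2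
        simp only [Bool.not_eq_true', decide_eq_false_iff_not]
        intro hy
        obtain ⟨h1, h2⟩ := (isYoungest_entries_iff (v := ⟨j, hj'⟩)).1 hy
        have h3 := hprec _ h1
        exact absurd (h3.2 (le_antisymm (h2 v hv) h3.1)) (not_le.2 hj)
    · rw [h, Finset.mem_insert, Prod.mk.injEq, Option.some_inj, or_comm, eq_comm (a := v)]

theorem onEndOfVertex_entries (i : ℕ) (M : G.EdgeSet) (u : Fin G.numOnline) :
    onEndOfVertex G.numOffline (entries i M (G.nbrs u)) =
      entries i (G.rankingStep (categoryPerm (G.category i)) M u) ∅ := by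
  obtain ⟨o, h1, h2⟩ := exists_pick_entries i M u
  refine map_range_eq_ofFn fun v => ?_
  have ho : o.map Fin.val = some v.val ↔ o = some v := by
    rcases o with _ | w
    · simp
    · simp [Fin.ext_iff]
  have hm : (∃ a, (a, v) ∈ G.rankingStep (categoryPerm (G.category i)) M u) ↔
      (∃ a, (a, v) ∈ M) ∨ o = some v := by
    simp only [h2, exists_or, exists_eq_left]
  simp only [getD_entries, h1, ho, entry_div_four]
  simp only [entry, hm, Finset.notMem_empty, if_false, add_zero]
  by_cases hov : o = some v
  · simp [hov]
  · simp only [hov, if_false, or_false]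
    split_ifs <;> omega

/-- The memory reached from `m` by reading `ts`. -/
def run (n : ℕ) (m : List Bool) (ts : List StreamToken) : List Bool :=
  ts.foldl (fun m t => (step n m t).1) m

theorem run_append (n : ℕ) (m : List Bool) (ts ts' : List StreamToken) :
    run n m (ts ++ ts') = run n (run n m ts) ts' :=
  List.foldl_append

theorem answers_append (n : ℕ) (m : List Bool) (ts ts' : List StreamToken) :
    algorithm.answers n m (ts ++ ts') =
      algorithm.answers n m ts ++ algorithm.answers n (run n m ts) ts' := by
  induction ts generalizing m with
  | nil => rfl
  | cons t ts ih =>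
    simp only [List.cons_append, StreamingAlgorithm.answers]
    have : run n m (t :: ts) = run n (algorithm.step n m t).1 ts := rfl
    rw [ih, this]
    split_ifs <;> rfl

theorem run_and_answers_neighbours (i : ℕ) (M : G.EdgeSet) (S : Finset (Fin G.numOffline))
    (l : List (Fin G.numOffline)) :
    run G.numOffline (write (entries i M S))
          (l.map fun v : Fin G.numOffline => some (some (v : ℕ))) =
        write (entries i M (S ∪ l.toFinset)) ∧
      algorithm.answers G.numOffline (write (entries i M S))
        (l.map fun v : Fin G.numOffline => some (some (v : ℕ))) = [] := by
  induction l generalizing S with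
  | nil => simp [run, StreamingAlgorithm.answers]
  | cons v l ih =>
    have hs : step G.numOffline (write (entries i M S)) (some (some v.val)) =
        (write (entries i M (insert v S)), none) := by
      simp only [step, read_write, onNeighbour_entries]
    obtain ⟨h1, h2⟩ := ih (insert v S)
    rw [List.map_cons]
    constructor
    · change run _ (step _ _ _).1 _ = _
      rw [hs, h1, List.toFinset_cons, Finset.insert_union, Finset.union_insert]
    · rw [StreamingAlgorithm.answers, if_neg (by simp)]
      change algorithm.answers _ (step _ _ _).1 _ = _
      rw [hs, h2]

theorem mate_eq_of_forall_mem_iff {M : G.EdgeSet} {u : Fin G.numOnline}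
    {o : Option (Fin G.numOffline)} (h : ∀ v, (u, v) ∈ M ↔ o = some v) : G.mate M u = o := by
  rw [mate]
  rcases o with _ | v
  · rw [List.find?_eq_none]
    intro v _
    simp [h]
  · have hp : (fun w => decide ((u, w) ∈ M)) = fun w => decide (w = v) := by
      funext w
      simp [h, eq_comm]
    rw [hp]
    rcases hf : (List.finRange G.numOffline).find? (fun w => decide (w = v)) with _ | w
    · rw [List.find?_eq_none] at hf
      simpa using hf v (List.mem_finRange v)
    · have := List.find?_some hf
      simp only [decide_eq_true_eq] at this
      rw [this]

theorem mem_foldl_rankingStep_iff {σ : Equiv.Perm (Fin G.numOffline)} {M : G.EdgeSet}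
    {us : List (Fin G.numOnline)} {u v} (hu : u ∉ us) :
    (u, v) ∈ us.foldl (G.rankingStep σ) M ↔ (u, v) ∈ M := by
  induction us generalizing M with
  | nil => rfl
  | cons a us ih =>
    rw [List.mem_cons, not_or] at hu
    rw [List.foldl_cons, ih hu.2]
    rcases rankingStep_cases σ M a with ⟨-, h⟩ | ⟨w, -, -, h⟩ <;> simp [h, hu.1]

/-- While the online vertices `us` are read, the memory follows Ranking, and the answer given for
each of them is its partner in the final matching, since partners are never changed. -/
theorem run_and_answers_vertices (i : ℕ) {L : Fin G.numOnline → List (Fin G.numOffline)}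
    (hL : ∀ u, (L u).toFinset = G.nbrs u) (us : List (Fin G.numOnline)) (hus : us.Nodup)
    (M : G.EdgeSet) (hM : ∀ u ∈ us, ∀ v, (u, v) ∉ M) :
    let ts := us.flatMap fun u =>
      ((L u).map fun v : Fin G.numOffline => some (some (v : ℕ))) ++ [some none]
    let M' := us.foldl (G.rankingStep (categoryPerm (G.category i))) M
    run G.numOffline (write (entries i M ∅)) ts = write (entries i M' ∅) ∧
      algorithm.answers G.numOffline (write (entries i M ∅)) ts =
        us.map fun u => (G.mate M' u).map Fin.val := by
  induction us generalizing M with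
  | nil => simp [run, StreamingAlgorithm.answers]
  | cons u us ih =>
    rw [List.nodup_cons] at hus
    have hu : ∀ v, (u, v) ∉ M := hM u List.mem_cons_self
    set M₁ := G.rankingStep (categoryPerm (G.category i)) M u with hM₁
    obtain ⟨o, ho1, ho2⟩ := exists_pick_entries i M u
    have hM1 : ∀ a ∈ us, ∀ v, (a, v) ∉ M₁ := fun a ha v hv => by
      rcases (ho2 a v).1 hv with h | ⟨rfl, -⟩
      · exact hM a (List.mem_cons_of_mem _ ha) v h
      · exact hus.1 ha
    obtain ⟨h1, h2⟩ := ih hus.2 M₁ hM1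
    obtain ⟨h3, h4⟩ := run_and_answers_neighbours i M ∅ (L u)
    rw [Finset.empty_union, hL] at h3
    have hs : step G.numOffline (write (entries i M (G.nbrs u))) (some none) =
        (write (entries i M₁ ∅), o.map Fin.val) := by
      simp only [step, read_write, onEndOfVertex_entries i M u, ho1, ← hM₁]
    have h5 : run G.numOffline (write (entries i M (G.nbrs u))) [some none] =
        write (entries i M₁ ∅) := congrArg Prod.fst hs
    have h6 : algorithm.answers G.numOffline (write (entries i M (G.nbrs u))) [some none] =
        [o.map Fin.val] := by
      rw [StreamingAlgorithm.answers, if_pos rfl]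
      change (step _ _ _).2 :: algorithm.answers _ _ [] = _
      rw [hs]
      rfl
    have hmate : G.mate (us.foldl (G.rankingStep (categoryPerm (G.category i))) M₁) u = o := by
      refine mate_eq_of_forall_mem_iff fun v => ?_
      rw [mem_foldl_rankingStep_iff hus.1, ho2]
      simp [hu v]
    simp only [List.flatMap_cons, List.foldl_cons, List.map_cons, run_append, answers_append,
      h3, h4, h5, h6, ← hM₁, hmate]
    exact ⟨h1, by rw [h2]; rfl⟩

/-- In the definition of `passTokens`, names are coerced to natural numbers by a monadic bind on the
list of neighbours; here this is a map. -/
theorem passTokens_eq (L : Fin G.numOnline → List (Fin G.numOffline)) :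
    G.passTokens L = ((List.finRange G.numOnline).flatMap fun u =>
      ((L u).map fun v : Fin G.numOffline => some (some (v : ℕ))) ++ [some none]) ++ [none] := by
  have h : ∀ l : List (Fin G.numOffline), (do let a ← l; pure (a : ℕ)) = l.map Fin.val := by
    intro l
    induction l <;> simp_all
  simp only [passTokens, h, List.map_map]
  rfl

theorem run_and_answers_passTokens (i : ℕ) {L : Fin G.numOnline → List (Fin G.numOffline)}
    (hL : ∀ u, (L u).toFinset = G.nbrs u) :
    run G.numOffline (write (entries (G := G) i ∅ ∅)) (G.passTokens L) =
        write (entries (i + 1) (∅ : G.EdgeSet) ∅) ∧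
      algorithm.answers G.numOffline (write (entries (G := G) i ∅ ∅)) (G.passTokens L) =
        List.ofFn fun u => (G.mate (G.categoryAdvice (i + 1)) u).map Fin.val := by
  obtain ⟨h1, h2⟩ := run_and_answers_vertices i hL (List.finRange G.numOnline)
    (List.nodup_finRange _) ∅ (by simp)
  have hf : (List.finRange G.numOnline).foldl
      (G.rankingStep (categoryPerm (G.category i))) ∅ = G.categoryAdvice (i + 1) := rfl
  rw [hf] at h1 h2
  rw [passTokens_eq, run_append, answers_append, h1, h2]
  constructor
  · change write (onEndOfPass _ (read _)) = _
    rw [read_write, onEndOfPass_entries]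
  · have : ∀ m, algorithm.answers G.numOffline m [none] = [] := fun m => by
      rw [StreamingAlgorithm.answers, if_neg (by simp)]
      rfl
    rw [this, List.append_nil, List.ofFn_eq_map]

theorem memory_replicate_passTokens {L : Fin G.numOnline → List (Fin G.numOffline)}
    (hL : ∀ u, (L u).toFinset = G.nbrs u) (i : ℕ) :
    algorithm.memory G.numOffline (List.replicate i (G.passTokens L)).flatten =
      write (entries i (∅ : G.EdgeSet) ∅) := by
  induction i with
  | zero =>
    change write _ = _
    congr 1
    exact map_range_eq_ofFn fun v => by simp [entry, age]
  | succ i ih =>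
    rw [List.replicate_succ', List.flatten_append, List.flatten_singleton]
    change run _ _ _ = _
    change run _ _ _ = _ at ih
    rw [run_append, ih, (run_and_answers_passTokens i hL).1]

theorem implementsCategoryAdvice {k : ℕ} (hk : 1 ≤ k) : algorithm.ImplementsCategoryAdvice k := by
  intro G L hL
  obtain ⟨i, rfl⟩ := Nat.exists_eq_add_of_le' hk
  rw [Nat.add_sub_cancel, memory_replicate_passTokens hL, (run_and_answers_passTokens i hL).2]

end CategoryStream

theorem mainTheorem1 :
    -- for each number of passes `k ≥ 1`: the exact ratio, with a tight instance
    (∀ k : ℕ, 1 ≤ k →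
      (∀ G : OnlineBipartite,
        (Nat.fib (2 * k) : ℝ) / (Nat.fib (2 * k + 1) : ℝ) * (G.opt : ℝ) ≤
          ((G.categoryAdvice k).card : ℝ)) ∧
      HasAsymptoticRatio (fun G => (G.categoryAdvice k).card)
        ((Nat.fib (2 * k) : ℝ) / (Nat.fib (2 * k + 1) : ℝ)) ∧
      (∃ G : OnlineBipartite,
        G.numOnline = Nat.fib (2 * k + 1) ∧ G.numOffline = Nat.fib (2 * k + 1) ∧
        G.opt = Nat.fib (2 * k + 1) ∧
        (G.categoryAdvice k).card = Nat.fib (2 * k) ∧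
        ∀ k' : ℕ, k < k' → (G.categoryAdvice k').card = Nat.fib (2 * k) + 1)) ∧
    -- the ratios converge to the inverse of the golden ratio
    (∀ ρ : ℕ → ℝ,
      (∀ k : ℕ, 1 ≤ k → HasAsymptoticRatio (fun G => (G.categoryAdvice k).card) (ρ k)) →
        Filter.Tendsto ρ Filter.atTop (nhds (2 / (1 + Real.sqrt 5)))) ∧
    -- the number of passes may depend on the size of the graph
    (∀ κ : ℕ → ℕ → ℕ,
      (∃ ρ : ℝ, ρ ≤ 2 / (1 + Real.sqrt 5) ∧
        HasAsymptoticRatio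
          (fun G => (G.categoryAdvice (κ G.numOnline G.numOffline)).card) ρ) ∧
      (Filter.Tendsto (fun p : ℕ × ℕ => κ p.1 p.2) (Filter.atTop ×ˢ Filter.atTop) Filter.atTop →
        HasAsymptoticRatio
          (fun G => (G.categoryAdvice (κ G.numOnline G.numOffline)).card)
          (2 / (1 + Real.sqrt 5)))) ∧
    -- for constant `k`, there is a semi-streaming implementation with `O(n)` bits of memory
    (∀ k : ℕ, 1 ≤ k →
      ∃ (A : StreamingAlgorithm) (C : ℕ), A.ImplementsCategoryAdvice k ∧ A.UsesLinearSpace k C) := by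
  refine ⟨fun k hk => ⟨OnlineBipartite.fib_div_fib_mul_opt_le k,
    hasAsymptoticRatio_categoryAdvice k hk, OnlineBipartite.tight k, ?_⟩, ?_, ?_, ?_⟩
  · obtain ⟨h1, h2, h3⟩ := OnlineBipartite.tight_spec k
    refine ⟨h1, h2, h3, ?_, fun k' hk' => ?_⟩
    · rw [OnlineBipartite.card_categoryAdvice_tight, if_neg (by omega), if_pos le_rfl]
    · rw [OnlineBipartite.card_categoryAdvice_tight, if_neg (by omega), if_neg (by omega)]
  · intro ρ hρ
    refine tendsto_fib_div_fib.congr' ?_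
    filter_upwards [Filter.eventually_ge_atTop 1] with k hk
    exact tendsto_nhds_unique (hasAsymptoticRatio_categoryAdvice k hk) (hρ k hk)
  · intro κ
    obtain ⟨ρ, hle, hρ⟩ := exists_hasAsymptoticRatio (sInf_ratios_categoryAdvice_le κ)
    refine ⟨⟨ρ, hle, hρ⟩, fun hκ => ?_⟩
    rwa [hρ.eq_of_tendsto hle hκ] at hρ
  · exact fun k hk => ⟨CategoryStream.algorithm, 4 * (k + 1),
      CategoryStream.implementsCategoryAdvice hk, CategoryStream.usesLinearSpace k⟩
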